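/- Fix integers $s,t,k\ge 2$, a real number $K$, and integers $1\le \ell_1,\dots,\ell_s\le k$. Definitions. $K_{s,t}^k$ is the graph obtained from the complete bipartite graph $K_{s,t}$ by replacing its edges with internally vertex-disjoint paths of length $k$; a graph is $K_{s,t}^k$-free if it has no (not necessarily induced) subgraph isomorphic to $K_{s,t}^k$. A finite graph $G$ is $K$-almost-regular if its maximum degree is at most $K$ times its minimum degree. An $s$-legged spider with length vector $(\ell_1,\dots,\ell_s)$ and leaf vector $(v_1,\dots,v_s)$ consists of a vertex $u$ (the centre) and paths $P_1,\dots,P_s$ (the legs), where $P_i$ has length $\ell_i$ and goes from $u$ to $v_i$, and any two of the paths share no vertex other than $u$; two spiders are different if $P_i\ne P_i'$ for some $i$. For a real number $L\ge 1$ let $f(1,L)=L$ and, for $\ell\ge 2$, $$f(\ell,L)=1+f(\ell-1,L)^{16}(\ell-1)^2\max_{1\le i\le \ell-1}f(i,L)f(\ell-i,L).$$ Every path of length $1$ is both $L$-admissible and $L$-good. A path of length $\ell\ge 2$ is $L$-admissible if each of its proper subpaths (of length at least $1$) is $L$-good; it is $L$-good if it is $L$-admissible and the number of $L$-admissible paths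 of length $\ell$ between its endpoints is at most $f(\ell,L)$. Every spider with length vector $(1,\dots,1)$ is $L$-admissible. A spider with centre $u$, legs $P_1,\dots,P_s$ and positive length vector $(\ell_1,\dots,\ell_s)\neq(1,\dots,1)$ is $L$-admissible if every leg $P_i$ is an $L$-good path and, for all $1\le i\le s$ and $1\le j<\ell_i$, the spider obtained by replacing $P_i$ with its initial segment of length $j$ starting at $u$ is $L$-good. A spider with length vector $(\ell_1,\dots,\ell_s)$ and leaf vector $(v_1,\dots,v_s)$ is $L$-good if it is $L$-admissible and the number of $L$-admissible spiders with length vector $(\ell_1,\dots,\ell_s)$ and leaf vector $(v_1,\dots,v_s)$ is at most $f(\ell_1+\dots+\ell_s,L)$. Lemma. There is a function $L\mapsto c'_L$ (depending only on $s,t,k,K,\ell_1,\dots,\ell_s$) with $c'_L\to 0$ as $L\to\infty$ such that for every real $L\ge 1$ there is $D$ with the following property. If $G$ is a $K_{s,t}^k$-free $K$-almost-regular graph on $n$ vertices with minimum degree $\delta\ge D$, then the number of $s$-legged spiders in $G$ with length vector $(\ell_1,\dots,\ell_s)$ which are $L$-admissible but not $L$-good is at most $c'_L\,n\,\delta^{\ell_1+\dots+\ell_s}$.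 -/

import Mathlib

/-- The `k`-subdivision of the complete bipartite graph with parts `Fin s` and `Fin t`.
Its vertices are the `s + t` branch vertices, together with the `k - 1` interior vertices of
each of the `s * t` subdivided edges. -/
abbrev SubdivVertex (s t k : ℕ) : Type :=
  (Fin s ⊕ Fin t) ⊕ (Fin s × Fin t × Fin (k - 1))

/-- The vertex at distance `a` (for `0 ≤ a ≤ k`) from the branch vertex `i` on the path of length
`k` which replaces the edge `ij`. -/
def subdivPoint (s t k : ℕ) (i : Fin s) (j : Fin t) (a : ℕ) : SubdivVertex s t k :=
  if a = 0 then Sum.inl (Sum.inl i)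
  else if h : a - 1 < k - 1 then Sum.inr (i, j, ⟨a - 1, h⟩)
  else Sum.inl (Sum.inr j)

/-- The graph `K_{s,t}^k`: every edge `ij` of `K_{s,t}` is replaced by a path of length `k`, these
paths being internally vertex-disjoint. -/
def subdividedCompleteBipartite (s t k : ℕ) : SimpleGraph (SubdivVertex s t k) :=
  SimpleGraph.fromRel fun x y =>
    ∃ (i : Fin s) (j : Fin t) (a : ℕ), a < k ∧
      x = subdivPoint s t k i j a ∧ y = subdivPoint s t k i j (a + 1)

/-- `G` is `K`-almost-regular: the maximum degree is at most `K` times the minimum degree. -/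
def IsAlmostRegular {V : Type*} [Fintype V] (K : ℝ) (G : SimpleGraph V) [DecidableRel G.Adj] :
    Prop :=
  (G.maxDegree : ℝ) ≤ K * (G.minDegree : ℝ)

/-- The function `f(ℓ, L)`, written `spiderBound L ℓ`: `f(1, L) = L` and, for `ℓ ≥ 2`,
`f(ℓ, L) = 1 + f(ℓ - 1, L) ^ 16 * (ℓ - 1) ^ 2 * max_{1 ≤ i ≤ ℓ - 1} f(i, L) * f(ℓ - i, L)`.
In the last line below `ℓ = m + 2`, and `i` is shifted by one. The value at `0` is never used. -/
noncomputable def spiderBound (L : ℝ) : ℕ → ℝ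
  | 0 => 0
  | 1 => L
  | m + 2 => 1 + spiderBound L (m + 1) ^ 16 * ((m : ℝ) + 1) ^ 2 *
      (Finset.univ : Finset (Fin (m + 1))).sup' Finset.univ_nonempty
        (fun i => spiderBound L (i.val + 1) * spiderBound L (m + 1 - i.val))
termination_by ℓ => ℓ
decreasing_by all_goals omega

section Paths

variable {V : Type*} {G : SimpleGraph V}

/-- `PathAdmissible L ℓ p` says that the walk `p` is an `L`-admissible path of length `ℓ`:
each proper subpath `q` of `p`, of length `m` with `1 ≤ m < ℓ`, is `L`-good, that is, it is
`L`-admissible and, unless `m = 1`, the number of `L`-admissible paths of length `m` between its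
endpoints is at most `f(m, L)`. -/
def PathAdmissible (L : ℝ) (ℓ : ℕ) {u v : V} (p : G.Walk u v) : Prop :=
  p.IsPath ∧ p.length = ℓ ∧
    ∀ m : ℕ, 1 ≤ m → m < ℓ → ∀ (x y : V) (q : G.Walk x y), q.length = m → q.IsSubwalk p →
      PathAdmissible L m q ∧
        (m = 1 ∨ ({r : G.Walk x y | PathAdmissible L m r}.ncard : ℝ) ≤ spiderBound L m)
termination_by ℓ

/-- `PathGood L ℓ p` says that `p` is an `L`-good path of length `ℓ`. Every path of length `1` is
`L`-good. -/
def PathGood (L : ℝ) (ℓ : ℕ) {u v : V} (p : G.Walk u v) : Prop :=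
  PathAdmissible L ℓ p ∧
    (ℓ = 1 ∨ ({r : G.Walk u v | PathAdmissible L ℓ r}.ncard : ℝ) ≤ spiderBound L ℓ)

/-- A path is `L`-admissible if and only if each of its proper subpaths is `L`-good. -/
theorem pathAdmissible_iff (L : ℝ) (ℓ : ℕ) {u v : V} (p : G.Walk u v) :
    PathAdmissible L ℓ p ↔ p.IsPath ∧ p.length = ℓ ∧
      ∀ m : ℕ, 1 ≤ m → m < ℓ → ∀ (x y : V) (q : G.Walk x y), q.length = m → q.IsSubwalk p →
        PathGood L m q := by
  rw [PathAdmissible]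
  rfl

end Paths

/-- An `s`-legged spider in `G`: a centre, and `s` paths (the legs) starting at the centre, which
pairwise share no vertex other than the centre. Two spiders are equal exactly when their `i`th
legs agree for every `i`. -/
structure Spider {V : Type*} (s : ℕ) (G : SimpleGraph V) where
  /-- the centre -/
  centre : V
  /-- the leaf vector -/
  leaf : Fin s → V
  /-- the legs -/
  leg : ∀ i, G.Walk centre (leaf i)
  isPath : ∀ i, (leg i).IsPath
  disjoint : ∀ i j, i ≠ j → ∀ x, x ∈ (leg i).support → x ∈ (leg j).support → x = centre

namespace Spider

variable {V : Type*} {s : ℕ} {G : SimpleGraph V}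

/-- The spider `S` has length vector `ℓ`. -/
def HasLengths (S : Spider s G) (ℓ : Fin s → ℕ) : Prop :=
  ∀ i, (S.leg i).length = ℓ i

/-- The subspider with the same centre whose `i`th leg consists of the first `m i` edges of the
`i`th leg of `S` (of the whole leg, if it has at most `m i` edges). -/
def trunc (S : Spider s G) (m : Fin s → ℕ) : Spider s G where
  centre := S.centre
  leaf i := (S.leg i).getVert (m i)
  leg i := (S.leg i).take (m i)
  isPath i := (S.isPath i).take (m i)
  disjoint i j hij x hi hj := S.disjoint i j hij x
    (((S.leg i).isSubwalk_take (m i)).support_subset hi)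
    (((S.leg j).isSubwalk_take (m j)).support_subset hj)

/-- `S.Admissible L ℓ` says that `S` is an `L`-admissible spider with length vector `ℓ`:
every leg is an `L`-good path, and each spider obtained from `S` by shortening one leg to a length
`1 ≤ j < ℓ i` is `L`-good, that is, it is `L`-admissible and the number of `L`-admissible spiders
with the same length vector and the same leaf vector is at most `f` of its total length.
Both conditions hold automatically for length vector `(1, …, 1)`. -/
def Admissible (L : ℝ) (ℓ : Fin s → ℕ) (S : Spider s G) : Prop :=
  S.HasLengths ℓ ∧
    (∀ (i : Fin s) (j : ℕ), 1 ≤ j → j < ℓ i →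
      Admissible L (Function.update ℓ i j) (S.trunc (Function.update ℓ i j)) ∧
        ({T : Spider s G | Admissible L (Function.update ℓ i j) T ∧
            T.leaf = (S.trunc (Function.update ℓ i j)).leaf}.ncard : ℝ) ≤
          spiderBound L (∑ a, Function.update ℓ i j a)) ∧
    ∀ i, PathGood L (ℓ i) (S.leg i)
termination_by ∑ a, ℓ a
decreasing_by
  all_goals
    refine Finset.sum_lt_sum (fun a _ => ?_) ⟨i, Finset.mem_univ i, by simpa using ‹j < ℓ i›⟩
    by_cases h : a = i
    · subst h
      simpa using le_of_lt ‹j < ℓ a›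
    · simp [h]

/-- `S.Good L ℓ` says that `S` is an `L`-good spider with length vector `ℓ`: it is `L`-admissible,
and at most `f(ℓ_1 + … + ℓ_s, L)` spiders with length vector `ℓ` and the leaf vector of `S` are
`L`-admissible. -/
def Good (L : ℝ) (ℓ : Fin s → ℕ) (S : Spider s G) : Prop :=
  Admissible L ℓ S ∧
    ({T : Spider s G | Admissible L ℓ T ∧ T.leaf = S.leaf}.ncard : ℝ) ≤ spiderBound L (∑ a, ℓ a)

/-- A spider is `L`-admissible if and only if its legs are `L`-good and shortening one leg always
gives an `L`-good spider. -/
theorem admissible_iff (L : ℝ) (ℓ : Fin s → ℕ) (S : Spider s G) :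
    S.Admissible L ℓ ↔ S.HasLengths ℓ ∧
      (∀ (i : Fin s) (j : ℕ), 1 ≤ j → j < ℓ i →
        (S.trunc (Function.update ℓ i j)).Good L (Function.update ℓ i j)) ∧
      ∀ i, PathGood L (ℓ i) (S.leg i) := by
  rw [Admissible]
  rfl

end Spider

/-! Suppose that more than `ε n δ^m` spiders are admissible but not good, where `m` is the total leg
length. The aim is a copy of the subdivided `K_{s,t}`.

Two features of bad spiders matter. First, a bad leaf vector carries more than `f(m, L)` admissible
spiders, while only a `1/L` fraction of `f(m, L)` can have a prescribed vertex at a prescribed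
non-leaf position: such a spider splits there into good pieces, and the recursion for `f` beats the
product of their bounds by a factor `L`. So for `L` large some spider with these leaves avoids any
given bounded set elsewhere (`ncard_through_finset_le`). Second, only about `n δ^(m-1)` spiders
arise on deleting one leaf, so typically a leaf can be moved in linearly many (in `δ`) ways. A
deletion argument (`exists_subset_le_card_fibers`) extracts a subfamily in which both hold within
the subfamily: a flexible family (`Spider.exists_flexible`).

In a flexible family, switching to a fresh spider with the same leaves and then moving leaf `i`
lengthens a path ending at leaf `i` by two edges, through the neighbour of that leaf on the leg.
Zigzagging in this way gives disjoint tails of length `k - ℓ i` from fixed vertices `x i`, and a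
last fresh spider joins them to a common centre by paths of length `k`. Doing this `t` times with
the same `x i`, always avoiding what has been used, gives the copy. If `k - ℓ i` is odd, `x i` is
the neighbour of a leaf instead of a leaf. This fails only when `k` is even and two legs have length
`1`, as both neighbours are then the centre.

In that exceptional case, fix a centre `c`. The pairs of leaves on the two short legs form a dense
bipartite relation inside the neighbourhood of `c`, which contains a large complete bipartite piece.
Each related pair has many common neighbours, namely the centres of fresh spiders with the same
leaves, so the target can be embedded with its even levels in the bipartite piece and its odd levels
at common neighbours. -/

section SpiderBasics

open Finset

variable {V : Type*} {s : ℕ} {G : SimpleGraph V}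

/-! ### Points of a spider, truncation, and counting by length vector. -/

namespace Spider

/-- The vertex at distance `a` from the centre on the `i`th leg. -/
def pt (S : Spider s G) (i : Fin s) (a : ℕ) : V := (S.leg i).getVert a

theorem pt_zero (S : Spider s G) (i : Fin s) : S.pt i 0 = S.centre := by
  simp [pt]

theorem HasLengths.pt_eq_leaf {S : Spider s G} {ℓ : Fin s → ℕ} (h : S.HasLengths ℓ) (i : Fin s) :
    S.pt i (ℓ i) = S.leaf i := by
  rw [pt, ← h i, SimpleGraph.Walk.getVert_length]

theorem HasLengths.pt_of_le {S : Spider s G} {ℓ : Fin s → ℕ} (h : S.HasLengths ℓ) {i : Fin s}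
    {a : ℕ} (ha : ℓ i ≤ a) : S.pt i a = S.leaf i :=
  SimpleGraph.Walk.getVert_of_length_le _ ((h i).trans_le ha)

theorem HasLengths.adj {S : Spider s G} {ℓ : Fin s → ℕ} (h : S.HasLengths ℓ) {i : Fin s} {a : ℕ}
    (ha : a < ℓ i) : G.Adj (S.pt i a) (S.pt i (a + 1)) :=
  (S.leg i).adj_getVert_succ (by rw [h i]; exact ha)

/-- Combines injectivity along each leg with disjointness of different legs; the centre, at position
`0` of every leg, is the only point with several names. -/
theorem HasLengths.pt_inj {S : Spider s G} {ℓ : Fin s → ℕ} (h : S.HasLengths ℓ) {i j : Fin s}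
    {a b : ℕ} (ha : a ≤ ℓ i) (hb : b ≤ ℓ j) (hab : S.pt i a = S.pt j b) :
    (a = 0 ∧ b = 0) ∨ (i = j ∧ a = b) := by
  by_cases hij : i = j
  · subst hij
    exact Or.inr ⟨rfl, (S.isPath i).getVert_injOn (by simpa [h i] using ha)
      (by simpa [h i] using hb) hab⟩
  · have h1 : S.pt i a ∈ (S.leg i).support := SimpleGraph.Walk.getVert_mem_support _ _
    have h2 : S.pt i a ∈ (S.leg j).support := by
      rw [hab]; exact SimpleGraph.Walk.getVert_mem_support _ _
    have h3 := S.disjoint i j hij _ h1 h2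
    have h4 : S.pt j b = S.centre := hab ▸ h3
    left
    constructor
    · rw [← S.pt_zero i] at h3
      exact (S.isPath i).getVert_injOn (by simpa [h i] using ha) (by simp) h3
    · rw [← S.pt_zero j] at h4
      exact (S.isPath j).getVert_injOn (by simpa [h j] using hb) (by simp) h4

theorem ext_pt {S S' : Spider s G} (hc : S.centre = S'.centre) (hl : S.leaf = S'.leaf)
    (h : ∀ i a, S.pt i a = S'.pt i a) : S = S' := by
  obtain ⟨c, v, leg, hp, hd⟩ := S
  obtain ⟨c', v', leg', hp', hd'⟩ := S'
  dsimp only at hc hl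
  subst hc hl
  have : leg = leg' := by
    funext i
    exact SimpleGraph.Walk.ext_getVert (h i)
  subst this
  rfl

theorem HasLengths.ext {S S' : Spider s G} {ℓ : Fin s → ℕ} (h : S.HasLengths ℓ)
    (h' : S'.HasLengths ℓ) (hc : S.centre = S'.centre)
    (hpt : ∀ i a, a ≤ ℓ i → S.pt i a = S'.pt i a) : S = S' := by
  have hl : S.leaf = S'.leaf := by
    funext i
    rw [← h.pt_eq_leaf i, ← h'.pt_eq_leaf i, hpt i _ le_rfl]
  refine ext_pt hc hl fun i a => ?_
  rcases le_total a (ℓ i) with ha | ha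
  · exact hpt i a ha
  · rw [h.pt_of_le ha, h'.pt_of_le ha, hl]

theorem pt_trunc (S : Spider s G) (m : Fin s → ℕ) (i : Fin s) (a : ℕ) :
    (S.trunc m).pt i a = S.pt i (min (m i) a) :=
  SimpleGraph.Walk.take_getVert _ _ _

theorem trunc_leaf (S : Spider s G) (m : Fin s → ℕ) (i : Fin s) :
    (S.trunc m).leaf i = S.pt i (m i) := rfl

theorem HasLengths.trunc {S : Spider s G} {ℓ m : Fin s → ℕ} (h : S.HasLengths ℓ)
    (hm : ∀ i, m i ≤ ℓ i) : (S.trunc m).HasLengths m := by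
  intro i
  change ((S.leg i).take (m i)).length = m i
  rw [SimpleGraph.Walk.take_length, h i, min_eq_left (hm i)]

theorem update_pred_le (ℓ : Fin s → ℕ) (i : Fin s) {j : ℕ} (hj : j ≤ ℓ i) (a : Fin s) :
    Function.update ℓ i j a ≤ ℓ a := by
  by_cases h : a = i
  · subst h; simpa using hj
  · simp [h]

/-- Two spiders which agree outside the last vertex of one leg, and have the same leaf there,
are equal. -/
theorem HasLengths.ext_of_trunc {S S' : Spider s G} {ℓ : Fin s → ℕ} (h : S.HasLengths ℓ)
    (h' : S'.HasLengths ℓ) (i : Fin s)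
    (ht : S.trunc (Function.update ℓ i (ℓ i - 1)) = S'.trunc (Function.update ℓ i (ℓ i - 1)))
    (hl : S.leaf i = S'.leaf i) : S = S' := by
  have hc : (S.trunc (Function.update ℓ i (ℓ i - 1))).centre =
      (S'.trunc (Function.update ℓ i (ℓ i - 1))).centre := by rw [ht]
  refine h.ext h' hc fun j a ha => ?_
  by_cases hj : j = i ∧ a = ℓ i
  · obtain ⟨rfl, rfl⟩ := hj
    rw [h.pt_eq_leaf, h'.pt_eq_leaf, hl]
  · have h1 := congrArg (fun T => T.pt j a) ht
    simp only [pt_trunc] at h1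
    have h2 : min (Function.update ℓ i (ℓ i - 1) j) a = a := by
      apply min_eq_right
      by_cases hji : j = i
      · subst hji
        simp only [Function.update_self]
        have : a ≠ ℓ j := fun e => hj ⟨rfl, e⟩
        omega
      · simpa [hji] using ha
    rwa [h2] at h1

theorem pt_eq_of_trunc_eq {S S' : Spider s G} {m : Fin s → ℕ} (ht : S.trunc m = S'.trunc m)
    {j : Fin s} {a : ℕ} (ha : a ≤ m j) : S.pt j a = S'.pt j a := by
  have h1 := congrArg (fun T => T.pt j a) ht
  simp only [pt_trunc] at h1
  rwa [min_eq_right ha] at h1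

/-- A spider of known lengths is determined by finitely many vertices. Since `Set.ncard` is `0` on
infinite sets, every count below depends on this. -/
theorem finite_hasLengths [Finite V] (ℓ : Fin s → ℕ) :
    {S : Spider s G | S.HasLengths ℓ}.Finite := by
  let φ : Spider s G → V × (∀ i : Fin s, Fin (ℓ i + 1) → V) :=
    fun S => (S.centre, fun i a => S.pt i a)
  refine Set.Finite.of_finite_image (f := φ) (Set.toFinite _) ?_
  intro S hS S' hS' he
  simp only [φ, Prod.mk.injEq] at he
  refine HasLengths.ext hS hS' he.1 fun i a ha => ?_
  exact congrFun (congrFun he.2 i) ⟨a, by omega⟩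

/-- In a graph on `n` vertices with maximum degree `Δ` there are at most `n * Δ ^ (∑ i, ℓ i)`
spiders with length vector `ℓ`. -/
theorem ncard_hasLengths_le [Fintype V] [DecidableRel G.Adj] (ℓ : Fin s → ℕ) :
    {S : Spider s G | S.HasLengths ℓ}.ncard ≤ Fintype.card V * G.maxDegree ^ (∑ i, ℓ i) := by
  classical
  induction hm : ∑ i, ℓ i generalizing ℓ with
  | zero =>
    have h0 : ∀ i, ℓ i = 0 := by simpa using hm
    rw [pow_zero, mul_one, ← Nat.card_eq_fintype_card, ← Set.ncard_univ]
    refine Set.ncard_le_ncard_of_injOn Spider.centre (fun _ _ => Set.mem_univ _) ?_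
    intro S hS S' hS' he
    refine HasLengths.ext hS hS' he fun i a ha => ?_
    obtain rfl : a = 0 := by have := h0 i; omega
    rw [pt_zero, pt_zero, he]
  | succ m ih =>
    obtain ⟨i, hi⟩ : ∃ i, 1 ≤ ℓ i := by
      by_contra! h
      have : ∑ i, ℓ i = 0 := Finset.sum_eq_zero fun i _ => by have := h i; omega
      omega
    set ℓ' := Function.update ℓ i (ℓ i - 1) with hℓ'
    have hsum : ∑ a, ℓ' a = m := by
      have h1 := Finset.add_sum_erase Finset.univ ℓ (Finset.mem_univ i)
      have h2 := Finset.add_sum_erase Finset.univ ℓ' (Finset.mem_univ i)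
      have h3 : ∑ x ∈ Finset.univ.erase i, ℓ' x = ∑ x ∈ Finset.univ.erase i, ℓ x :=
        Finset.sum_congr rfl fun x hx => by simp [hℓ', Finset.ne_of_mem_erase hx]
      have h4 : ℓ' i = ℓ i - 1 := by simp [hℓ']
      omega
    have hfin := finite_hasLengths (G := G) ℓ
    have hfin' := finite_hasLengths (G := G) ℓ'
    have hle : ∀ a, ℓ' a ≤ ℓ a := update_pred_le ℓ i (Nat.sub_le _ _)
    rw [Set.ncard_eq_toFinset_card _ hfin]
    -- Restoring the deleted last vertex of leg `i` means choosing a neighbour of the truncated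
    -- leaf, so there are at most `G.maxDegree` ways.
    have key : hfin.toFinset.card ≤ G.maxDegree * hfin'.toFinset.card := by
      refine Finset.card_le_mul_card_image_of_maps_to (f := fun S => S.trunc ℓ') ?_ _ ?_
      · intro S hS
        rw [Set.Finite.mem_toFinset] at hS ⊢
        exact HasLengths.trunc hS hle
      · intro R hR
        by_cases hex : ∃ S ∈ hfin.toFinset, S.trunc ℓ' = R
        · obtain ⟨S₀, hS₀, hR₀⟩ := hex
          refine le_trans ?_ (G.degree_le_maxDegree (R.leaf i))
          rw [← SimpleGraph.card_neighborFinset_eq_degree]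
          refine Finset.card_le_card_of_injOn (fun S => S.leaf i) ?_ ?_
          · intro S hS
            simp only [Finset.coe_filter, Set.Finite.mem_toFinset, Set.mem_ofPred_eq] at hS
            simp only [Finset.mem_coe, SimpleGraph.mem_neighborFinset]
            rw [← hS.2, trunc_leaf, ← hS.1.pt_eq_leaf i]
            have := hS.1.adj (i := i) (a := ℓ i - 1) (by omega)
            rw [Nat.sub_add_cancel hi] at this
            simpa [hℓ'] using this
          · intro S hS S' hS' he
            simp only [Finset.coe_filter, Set.Finite.mem_toFinset, Set.mem_ofPred_eq] at hS hS'
            exact hS.1.ext_of_trunc hS'.1 i (hS.2.trans hS'.2.symm) he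
        · rw [Finset.card_eq_zero.2]
          · exact Nat.zero_le _
          · rw [Finset.filter_eq_empty_iff]
            intro S hS he
            exact hex ⟨S, hS, he⟩
    rw [← Set.ncard_eq_toFinset_card _ hfin'] at key
    calc _ ≤ G.maxDegree * (Fintype.card V * G.maxDegree ^ m) :=
          key.trans (Nat.mul_le_mul_left _ (ih ℓ' hsum))
      _ = _ := by ring

end Spider

theorem finite_walk_length [Finite V] (u v : V) (m : ℕ) :
    {p : G.Walk u v | p.length = m}.Finite := by
  let φ : G.Walk u v → (Fin (m + 1) → V) := fun p a => p.getVert a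
  refine Set.Finite.of_finite_image (f := φ) (Set.toFinite _) ?_
  intro p hp q hq he
  refine SimpleGraph.Walk.ext_getVert_le_length (hp.trans hq.symm) fun a ha => ?_
  have ha' : a < m + 1 := by
    have : p.length = m := hp
    omega
  exact congrFun he ⟨a, ha'⟩

end SpiderBasics

/-! ### Growth of the function `f`. -/

section SpiderBound

open Finset

variable {L : ℝ}

theorem spiderBound_one (L : ℝ) : spiderBound L 1 = L := by
  rw [spiderBound]

theorem one_le_spiderBound (hL : 1 ≤ L) : ∀ m : ℕ, 1 ≤ m → 1 ≤ spiderBound L m := by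
  intro m
  induction m using Nat.strong_induction_on with
  | _ m ih =>
    intro hm
    match m, hm with
    | 1, _ => rwa [spiderBound_one]
    | m + 2, _ =>
      rw [spiderBound]
      have h1 := ih (m + 1) (by omega) (by omega)
      have h2 : (0 : ℝ) ≤ (Finset.univ : Finset (Fin (m + 1))).sup' Finset.univ_nonempty
          (fun i => spiderBound L (i.val + 1) * spiderBound L (m + 1 - i.val)) := by
        refine le_trans ?_ (Finset.le_sup' _ (Finset.mem_univ (0 : Fin (m + 1))))
        have h3 := ih 1 (by omega) (by omega)
        simp only [Fin.val_zero, zero_add, tsub_zero]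
        nlinarith
      have : 0 ≤ spiderBound L (m + 1) ^ 16 * ((m : ℝ) + 1) ^ 2 *
        (Finset.univ : Finset (Fin (m + 1))).sup' Finset.univ_nonempty
        (fun i => spiderBound L (i.val + 1) * spiderBound L (m + 1 - i.val)) := by positivity
      linarith

/-- The maximum in the recursion is at least its term at `i = a`; the summand `1` and the factor `(a
+ b - 1) ^ 2` are thrown away. -/
theorem pow_mul_spiderBound_mul_le (hL : 1 ≤ L) {a b : ℕ} (ha : 1 ≤ a) (hb : 1 ≤ b) :
    spiderBound L (a + b - 1) ^ 16 * (spiderBound L a * spiderBound L b) ≤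
      spiderBound L (a + b) := by
  obtain ⟨m, hm⟩ : ∃ m, a + b = m + 2 := ⟨a + b - 2, by omega⟩
  rw [hm, show m + 2 - 1 = m + 1 by omega, spiderBound]
  set M := (Finset.univ : Finset (Fin (m + 1))).sup' Finset.univ_nonempty
        (fun i => spiderBound L (i.val + 1) * spiderBound L (m + 1 - i.val)) with hM
  have h1 : spiderBound L a * spiderBound L b ≤ M := by
    have := Finset.le_sup' (fun i : Fin (m + 1) =>
      spiderBound L (i.val + 1) * spiderBound L (m + 1 - i.val))
      (Finset.mem_univ (⟨a - 1, by omega⟩ : Fin (m + 1)))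
    rw [← hM] at this
    simp only at this
    rwa [show a - 1 + 1 = a by omega, show m + 1 - (a - 1) = b by omega] at this
  have ha' := one_le_spiderBound hL a ha
  have hb' := one_le_spiderBound hL b hb
  have h2 : 0 ≤ spiderBound L a * spiderBound L b := by positivity
  have h3 := one_le_spiderBound hL (m + 1) (by omega)
  have h4 : (1 : ℝ) ≤ ((m : ℝ) + 1) ^ 2 := one_le_pow₀ (by linarith [(Nat.cast_nonneg m : (0:ℝ) ≤ m)])
  have h5 : spiderBound L (m + 1) ^ 16 * 1 * (spiderBound L a * spiderBound L b) ≤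
      spiderBound L (m + 1) ^ 16 * ((m : ℝ) + 1) ^ 2 * M := by gcongr
  linarith

theorem spiderBound_mul_le (hL : 1 ≤ L) {a b : ℕ} (ha : 1 ≤ a) (hb : 1 ≤ b) :
    spiderBound L a * spiderBound L b ≤ spiderBound L (a + b) := by
  refine le_trans ?_ (pow_mul_spiderBound_mul_le hL ha hb)
  have ha' := one_le_spiderBound hL a ha
  have hb' := one_le_spiderBound hL b hb
  exact le_mul_of_one_le_left (by positivity)
    (one_le_pow₀ (one_le_spiderBound hL _ (by omega)))

theorem le_spiderBound (hL : 1 ≤ L) {m : ℕ} (hm : 1 ≤ m) : L ≤ spiderBound L m := by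
  rcases Nat.lt_or_ge 1 m with h | h
  · have h1 := spiderBound_mul_le hL (a := 1) (b := m - 1) le_rfl (by omega)
    rw [spiderBound_one, show 1 + (m - 1) = m by omega] at h1
    have h2 := one_le_spiderBound hL (m - 1) (by omega)
    nlinarith
  · obtain rfl : m = 1 := by omega
    rw [spiderBound_one]

/-- The source of the gain `L`: cutting a spider into two good pieces leaves a factor `L` to spare.
Of the sixteenth power only one factor, itself at least `L`, is needed. -/
theorem mul_spiderBound_mul_le (hL : 1 ≤ L) {a b : ℕ} (ha : 1 ≤ a) (hb : 1 ≤ b) :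
    L * (spiderBound L a * spiderBound L b) ≤ spiderBound L (a + b) := by
  refine le_trans ?_ (pow_mul_spiderBound_mul_le hL ha hb)
  have ha' := one_le_spiderBound hL a ha
  have hb' := one_le_spiderBound hL b hb
  have h1 := le_spiderBound hL (m := a + b - 1) (by omega)
  have h2 : spiderBound L (a + b - 1) ≤ spiderBound L (a + b - 1) ^ 16 :=
    le_self_pow₀ (hL.trans h1) (by norm_num)
  gcongr
  exact h1.trans h2

theorem prod_spiderBound_le (hL : 1 ≤ L) {ι : Type*} {J : Finset ι} (hJ : J.Nonempty)
    (ℓ : ι → ℕ) (hℓ : ∀ i, 1 ≤ ℓ i) :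
    ∏ i ∈ J, spiderBound L (ℓ i) ≤ spiderBound L (∑ i ∈ J, ℓ i) := by
  classical
  induction hJ using Finset.Nonempty.cons_induction with
  | singleton a => simp
  | cons a J ha hJ ih =>
    rw [Finset.prod_cons, Finset.sum_cons]
    have h1 : 1 ≤ ∑ i ∈ J, ℓ i := by
      obtain ⟨j, hj⟩ := hJ
      exact (hℓ j).trans (Finset.single_le_sum (fun _ _ => Nat.zero_le _) hj)
    have h2 := one_le_spiderBound hL _ (hℓ a)
    exact (mul_le_mul_of_nonneg_left ih (by linarith)).trans (spiderBound_mul_le hL (hℓ a) h1)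

end SpiderBound

/-! ### Admissible spiders with fixed leaves passing through a fixed vertex. -/

section ThroughVertex

open Finset

variable {V : Type*} {s : ℕ} {G : SimpleGraph V} {L : ℝ}

theorem PathAdmissible.isPath_length {m : ℕ} {u v : V} {p : G.Walk u v}
    (h : PathAdmissible L m p) : p.IsPath ∧ p.length = m := by
  rw [pathAdmissible_iff] at h
  exact ⟨h.1, h.2.1⟩

theorem finite_pathAdmissible [Finite V] (L : ℝ) (m : ℕ) (u v : V) :
    {r : G.Walk u v | PathAdmissible L m r}.Finite :=
  (finite_walk_length u v m).subset fun _ h => h.isPath_length.2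

/-- Paths of length `1` are good by decree, without a count; there is at most one between two given
vertices, and `1 ≤ L = f(1, L)`. -/
theorem PathGood.ncard_le [Finite V] (hL : 1 ≤ L) {m : ℕ} {u v : V} {p : G.Walk u v}
    (h : PathGood L m p) :
    ({r : G.Walk u v | PathAdmissible L m r}.ncard : ℝ) ≤ spiderBound L m := by
  rcases h.2 with rfl | h'
  · rw [spiderBound_one]
    refine le_trans ?_ hL
    have : {r : G.Walk u v | PathAdmissible L 1 r}.ncard ≤ 1 := by
      rw [Set.ncard_le_one (finite_pathAdmissible L 1 u v)]
      intro p hp q hq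
      have hp1 := hp.isPath_length.2
      have hq1 := hq.isPath_length.2
      refine SimpleGraph.Walk.ext_getVert_le_length (hp1.trans hq1.symm) fun a ha => ?_
      rw [hp1] at ha
      interval_cases a
      · simp
      · have e1 := p.getVert_length
        have e2 := q.getVert_length
        rw [hp1] at e1
        rw [hq1] at e2
        rw [e1, e2]
    exact_mod_cast this
  · exact h'

namespace Spider

theorem Admissible.hasLengths {ℓ : Fin s → ℕ} {S : Spider s G} (h : S.Admissible L ℓ) :
    S.HasLengths ℓ := by
  rw [admissible_iff] at h
  exact h.1

theorem Admissible.pathGood {ℓ : Fin s → ℕ} {S : Spider s G} (h : S.Admissible L ℓ) (i : Fin s) :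
    PathGood L (ℓ i) (S.leg i) := by
  rw [admissible_iff] at h
  exact h.2.2 i

theorem Admissible.good_trunc {ℓ : Fin s → ℕ} {S : Spider s G} (h : S.Admissible L ℓ) {i : Fin s}
    {j : ℕ} (h1 : 1 ≤ j) (hj : j < ℓ i) :
    (S.trunc (Function.update ℓ i j)).Good L (Function.update ℓ i j) := by
  rw [admissible_iff] at h
  exact h.2.1 i j h1 hj

theorem finite_admissible [Finite V] (ℓ : Fin s → ℕ) :
    {S : Spider s G | S.Admissible L ℓ}.Finite :=
  (finite_hasLengths ℓ).subset fun _ h => h.hasLengths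

theorem Admissible.pathGood_drop {ℓ : Fin s → ℕ} {S : Spider s G} (h : S.Admissible L ℓ)
    {i : Fin s} {j : ℕ} (h1 : 1 ≤ j) (hj : j < ℓ i) :
    PathGood L (ℓ i - j) ((S.leg i).drop j) := by
  have h2 := (h.pathGood i).1
  rw [pathAdmissible_iff] at h2
  exact h2.2.2 (ℓ i - j) (by omega) (by omega) _ _ _
    (by rw [SimpleGraph.Walk.drop_length, h.hasLengths i]) ((S.leg i).isSubwalk_drop j)

/-- Few admissible spiders with a given leaf vector have a given vertex at a given inner position
of a given leg. -/
theorem ncard_through_leg_le [Finite V] (hL : 1 ≤ L) (ℓ : Fin s → ℕ) (hℓ : ∀ i, 1 ≤ ℓ i)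
    (v : Fin s → V) (i : Fin s) {j : ℕ} (h1 : 1 ≤ j) (hj : j < ℓ i) (z : V) :
    L * ({S : Spider s G | S.Admissible L ℓ ∧ S.leaf = v ∧ S.pt i j = z}.ncard : ℝ) ≤
      spiderBound L (∑ a, ℓ a) := by
  classical
  have hpos : 1 ≤ ∑ a, ℓ a :=
    (hℓ i).trans (Finset.single_le_sum (fun _ _ => Nat.zero_le _) (Finset.mem_univ i))
  set A := {S : Spider s G | S.Admissible L ℓ ∧ S.leaf = v ∧ S.pt i j = z} with hA
  rcases A.eq_empty_or_nonempty with he | ⟨S₀, hS₀, rfl, rfl⟩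
  · rw [he, Set.ncard_empty]
    have := one_le_spiderBound hL _ hpos
    simp only [Nat.cast_zero, mul_zero]
    linarith
  set ℓ' := Function.update ℓ i j with hℓ'
  set B₁ := {T : Spider s G | T.Admissible L ℓ' ∧ T.leaf = (S₀.trunc ℓ').leaf} with hB₁
  set W := {r : G.Walk (S₀.pt i j) (S₀.leaf i) | PathAdmissible L (ℓ i - j) r} with hW
  -- Paths are recorded as vertex sequences, so that remainders of different spiders, whose
  -- endpoints are only propositionally equal, live in one type.
  set B₂ : Set (ℕ → V) := (fun r => r.getVert) '' W with hB₂
  have hB₁fin : B₁.Finite := (finite_admissible ℓ').subset fun _ h => h.1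
  have hWfin : W.Finite := finite_pathAdmissible _ _ _ _
  -- Cutting leg `i` at `z` encodes a spider by its truncation, whose leaf vector is now fixed, and
  -- by the rest of the leg. Both are good, which bounds the two sets of choices.
  have hcard : A.ncard ≤ (B₁ ×ˢ B₂).ncard := by
    refine Set.ncard_le_ncard_of_injOn
      (fun S => (S.trunc ℓ', fun a => S.pt i (j + a))) ?_ ?_ (hB₁fin.prod (hWfin.image _))
    · rintro S ⟨hS, hSl, hSz⟩
      refine ⟨⟨(hS.good_trunc h1 hj).1, ?_⟩, ?_⟩
      · funext a
        rw [trunc_leaf, trunc_leaf]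
        by_cases ha : a = i
        · subst ha
          simp [hℓ', hSz]
        · simp only [hℓ', Function.update_of_ne ha]
          rw [hS.hasLengths.pt_eq_leaf, hS₀.hasLengths.pt_eq_leaf, hSl]
      · refine ⟨((S.leg i).drop j).copy hSz (congrFun hSl i), ?_, ?_⟩
        · have h3 := (hS.pathGood_drop h1 hj).1
          have key : ∀ {x y x' y' : V} (e : x = x') (e' : y = y') (r : G.Walk x y),
              PathAdmissible L (ℓ i - j) r → PathAdmissible L (ℓ i - j) (r.copy e e') := by
            rintro _ _ _ _ rfl rfl r hr
            exact hr
          exact key _ _ _ h3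
        · funext a
          exact (SimpleGraph.Walk.getVert_copy _ _ _ _).trans
            (SimpleGraph.Walk.drop_getVert _ _ _)
    · rintro S ⟨hS, -, -⟩ S' ⟨hS', -, -⟩ hSS
      simp only [Prod.mk.injEq] at hSS
      refine hS.hasLengths.ext hS'.hasLengths (S.pt_zero i ▸ S'.pt_zero i ▸
        pt_eq_of_trunc_eq hSS.1 (Nat.zero_le _)) fun b a ha => ?_
      by_cases hb : b = i
      · subst hb
        rcases le_total a j with haj | haj
        · exact pt_eq_of_trunc_eq hSS.1 (by simpa [hℓ'] using haj)
        · have := congrFun hSS.2 (a - j)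
          simpa [Nat.add_sub_cancel' haj] using this
      · exact pt_eq_of_trunc_eq hSS.1 (by simpa [hℓ', hb] using ha)
  rw [Set.ncard_prod] at hcard
  have hb1 : (B₁.ncard : ℝ) ≤ spiderBound L (∑ a, ℓ' a) := (hS₀.good_trunc h1 hj).2
  have hb2 : (B₂.ncard : ℝ) ≤ spiderBound L (ℓ i - j) :=
    le_trans (by exact_mod_cast Set.ncard_image_le hWfin) ((hS₀.pathGood_drop h1 hj).ncard_le hL)
  have hsum : ∑ a, ℓ' a + (ℓ i - j) = ∑ a, ℓ a := by
    have h1 := Finset.add_sum_erase Finset.univ ℓ (Finset.mem_univ i)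
    have h2 := Finset.add_sum_erase Finset.univ ℓ' (Finset.mem_univ i)
    have h3 : ∑ x ∈ Finset.univ.erase i, ℓ' x = ∑ x ∈ Finset.univ.erase i, ℓ x :=
      Finset.sum_congr rfl fun x hx => by simp [hℓ', Finset.ne_of_mem_erase hx]
    have h4 : ℓ' i = j := by simp [hℓ']
    omega
  have hpos' : 1 ≤ ∑ a, ℓ' a := by
    refine le_trans ?_ (Finset.single_le_sum (f := ℓ') (fun _ _ => Nat.zero_le _)
      (Finset.mem_univ i))
    simpa [hℓ'] using h1
  have h5 := one_le_spiderBound hL _ hpos'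
  calc L * (A.ncard : ℝ) ≤ L * ((B₁.ncard : ℝ) * B₂.ncard) := by
        gcongr; exact_mod_cast hcard
    _ ≤ L * (spiderBound L (∑ a, ℓ' a) * spiderBound L (ℓ i - j)) := by gcongr
    _ ≤ spiderBound L (∑ a, ℓ' a + (ℓ i - j)) := mul_spiderBound_mul_le hL hpos' (by omega)
    _ = _ := by rw [hsum]

/-- Few admissible spiders with a given leaf vector have a given centre. -/
theorem ncard_through_centre_le [Finite V] (hs : 2 ≤ s) (hL : 1 ≤ L) (ℓ : Fin s → ℕ)
    (hℓ : ∀ i, 1 ≤ ℓ i) (v : Fin s → V) (z : V) :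
    L * ({S : Spider s G | S.Admissible L ℓ ∧ S.leaf = v ∧ S.centre = z}.ncard : ℝ) ≤
      spiderBound L (∑ a, ℓ a) := by
  classical
  have i₀ : Fin s := ⟨0, by omega⟩
  -- Two legs are needed: the factor `L` is gained on splitting the total length into two positive
  -- parts, here one leg against all the others.
  have hne : (Finset.univ.erase i₀ : Finset (Fin s)).Nonempty := by
    rw [← Finset.card_pos, Finset.card_erase_of_mem (Finset.mem_univ _), Finset.card_univ,
      Fintype.card_fin]
    omega
  have hsum := Finset.add_sum_erase Finset.univ ℓ (Finset.mem_univ i₀)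
  have hrest : 1 ≤ ∑ a ∈ Finset.univ.erase i₀, ℓ a := by
    obtain ⟨j, hj⟩ := hne
    exact (hℓ j).trans (Finset.single_le_sum (fun _ _ => Nat.zero_le _) hj)
  set A := {S : Spider s G | S.Admissible L ℓ ∧ S.leaf = v ∧ S.centre = z} with hA
  rcases A.eq_empty_or_nonempty with he | ⟨S₀, hS₀, rfl, rfl⟩
  · rw [he, Set.ncard_empty]
    have := one_le_spiderBound hL (∑ a, ℓ a) (by have := hℓ i₀; omega)
    simp only [Nat.cast_zero, mul_zero]
    linarith
  set W : ∀ i, Set (G.Walk S₀.centre (S₀.leaf i)) := fun i => {r | PathAdmissible L (ℓ i) r}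
  have hWfin : ∀ i, (W i).Finite := fun i => finite_pathAdmissible _ _ _ _
  set B : ∀ i, Finset (ℕ → V) := fun i => ((hWfin i).image (fun r => r.getVert)).toFinset with hB
  have hBcard : ∀ i, ((B i).card : ℝ) ≤ spiderBound L (ℓ i) := by
    intro i
    rw [hB, ← Set.ncard_eq_toFinset_card _ ((hWfin i).image _)]
    exact le_trans (by exact_mod_cast Set.ncard_image_le (hWfin i)) ((hS₀.pathGood i).ncard_le hL)
  have hcard : A.ncard ≤ (Fintype.piFinset B).card := by
    rw [← Set.ncard_coe_finset]
    refine Set.ncard_le_ncard_of_injOn (fun S i a => S.pt i a) ?_ ?_ (Finset.finite_toSet _)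
    · rintro S ⟨hS, hSl, hSz⟩
      rw [Finset.mem_coe, Fintype.mem_piFinset]
      intro i
      rw [hB, Set.Finite.mem_toFinset]
      refine ⟨(S.leg i).copy hSz (congrFun hSl i), ?_, ?_⟩
      · have key : ∀ {x y x' y' : V} (e : x = x') (e' : y = y') (r : G.Walk x y),
            PathAdmissible L (ℓ i) r → PathAdmissible L (ℓ i) (r.copy e e') := by
          rintro _ _ _ _ rfl rfl r hr
          exact hr
        exact key _ _ _ (hS.pathGood i).1
      · funext a
        simp [pt]
    · rintro S ⟨hS, hSl, hSz⟩ S' ⟨hS', hSl', hSz'⟩ hSS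
      exact ext_pt (hSz.trans hSz'.symm) (hSl.trans hSl'.symm)
        fun i a => congrFun (congrFun hSS i) a
  rw [Fintype.card_piFinset] at hcard
  calc L * (A.ncard : ℝ) ≤ L * ∏ i, ((B i).card : ℝ) := by
        gcongr; exact_mod_cast hcard
    _ ≤ L * ∏ i, spiderBound L (ℓ i) := by
        gcongr with i; exact hBcard i
    _ = L * (spiderBound L (ℓ i₀) * ∏ i ∈ Finset.univ.erase i₀, spiderBound L (ℓ i)) := by
        rw [Finset.mul_prod_erase _ (fun i => spiderBound L (ℓ i)) (Finset.mem_univ i₀)]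
    _ ≤ L * (spiderBound L (ℓ i₀) * spiderBound L (∑ i ∈ Finset.univ.erase i₀, ℓ i)) := by
        have := one_le_spiderBound hL _ (hℓ i₀)
        gcongr
        exact prod_spiderBound_le hL hne ℓ hℓ
    _ ≤ spiderBound L (ℓ i₀ + ∑ i ∈ Finset.univ.erase i₀, ℓ i) :=
        mul_spiderBound_mul_le hL (hℓ i₀) hrest
    _ = _ := by rw [hsum]

/-- Few admissible spiders with a given leaf vector have a non-leaf vertex in a given small set. -/
theorem ncard_through_finset_le [Finite V] (hs : 2 ≤ s) (hL : 1 ≤ L) (ℓ : Fin s → ℕ)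
    (hℓ : ∀ i, 1 ≤ ℓ i) (v : Fin s → V) (F : Finset V) :
    L * ({S : Spider s G | S.Admissible L ℓ ∧ S.leaf = v ∧
        ∃ i a, a < ℓ i ∧ S.pt i a ∈ F}.ncard : ℝ) ≤
      F.card * (∑ i, ℓ i) * spiderBound L (∑ a, ℓ a) := by
  classical
  set P : Finset (Σ _ : Fin s, ℕ) := Finset.univ.sigma fun i => Finset.range (ℓ i) with hP
  have hPcard : P.card = ∑ i, ℓ i := by simp [hP]
  set X : V → (Σ _ : Fin s, ℕ) → Set (Spider s G) := fun z p =>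
    {S | S.Admissible L ℓ ∧ S.leaf = v ∧ S.pt p.1 p.2 = z} with hX
  have hXcard : ∀ z, ∀ p ∈ P, L * ((X z p).ncard : ℝ) ≤ spiderBound L (∑ a, ℓ a) := by
    rintro z ⟨i, a⟩ hp
    have ha : a < ℓ i := by simpa [hP] using hp
    rcases Nat.eq_zero_or_pos a with rfl | h0
    · simpa only [hX, pt_zero] using ncard_through_centre_le hs hL ℓ hℓ v z
    · exact ncard_through_leg_le hL ℓ hℓ v i h0 ha z
  have hsub : {S : Spider s G | S.Admissible L ℓ ∧ S.leaf = v ∧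
      ∃ i a, a < ℓ i ∧ S.pt i a ∈ F} ⊆ ⋃ q ∈ F ×ˢ P, X q.1 q.2 := by
    rintro S ⟨hS, hl, i, a, ha, hF⟩
    simp only [Set.mem_iUnion]
    exact ⟨(S.pt i a, ⟨i, a⟩), by simp [hP, hF, ha], hS, hl, rfl⟩
  have hfin : (⋃ q ∈ F ×ˢ P, X q.1 q.2).Finite :=
    (Finset.finite_toSet (F ×ˢ P)).biUnion fun q _ =>
      (finite_admissible (G := G) (L := L) ℓ).subset fun _ h => h.1
  have h1 := (Set.ncard_le_ncard hsub hfin).trans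
    (Finset.set_ncard_biUnion_le (F ×ˢ P) fun q => X q.1 q.2)
  have h2 : ({S : Spider s G | S.Admissible L ℓ ∧ S.leaf = v ∧
      ∃ i a, a < ℓ i ∧ S.pt i a ∈ F}.ncard : ℝ) ≤ ∑ q ∈ F ×ˢ P, ((X q.1 q.2).ncard : ℝ) := by
    exact_mod_cast h1
  calc _ ≤ L * ∑ q ∈ F ×ˢ P, ((X q.1 q.2).ncard : ℝ) := by gcongr
    _ = ∑ q ∈ F ×ˢ P, L * ((X q.1 q.2).ncard : ℝ) := by rw [Finset.mul_sum]
    _ ≤ ∑ q ∈ F ×ˢ P, spiderBound L (∑ a, ℓ a) :=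
        Finset.sum_le_sum fun q hq => hXcard _ _ (Finset.mem_product.1 hq).2
    _ = _ := by
        rw [Finset.sum_const, Finset.card_product, hPcard, nsmul_eq_mul]
        push_cast
        ring

end Spider

end ThroughVertex

/-! ### From many bad spiders to a flexible family. -/

section Cleaning

open Finset

/-- If the thresholds `θ i y`, summed over all fibres of all the maps `g i` on `B`, are less than
`#B`, then `B` has a nonempty subset all of whose fibres reach their thresholds. -/
theorem exists_subset_le_card_fibers {α ι : Type*} [Fintype ι] [DecidableEq α] {β : ι → Type*}
    [∀ i, DecidableEq (β i)] (g : ∀ i, α → β i) (θ : ∀ i, β i → ℝ) (hθ : ∀ i y, 0 ≤ θ i y)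
    (B : Finset α) (hB : ∑ i, ∑ y ∈ B.image (g i), θ i y < B.card) :
    ∃ T ⊆ B, T.Nonempty ∧ ∀ i, ∀ x ∈ T, θ i (g i x) ≤ ({x' ∈ T | g i x' = g i x}.card : ℝ) := by
  classical
  induction B using Finset.strongInduction with
  | H B ih =>
    by_cases h : ∀ i, ∀ x ∈ B, θ i (g i x) ≤ ({x' ∈ B | g i x' = g i x}.card : ℝ)
    · refine ⟨B, Finset.Subset.refl _, ?_, h⟩
      rw [← Finset.card_pos]
      have : (0 : ℝ) < B.card := lt_of_le_of_lt
        (Finset.sum_nonneg fun i _ => Finset.sum_nonneg fun y _ => hθ i y) hB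
      exact_mod_cast this
    · push Not at h
      obtain ⟨i, x, hx, hlt⟩ := h
      -- Deleting a deficient fibre costs fewer than `θ i (g i x)` elements, but also removes `g i
      -- x` from the image of `g i`, so the sum of thresholds drops by at least that much and the
      -- strict inequality persists.
      set B' := {x' ∈ B | ¬ g i x' = g i x} with hB'
      have hss : B' ⊂ B := by
        refine (Finset.ssubset_iff_of_subset (Finset.filter_subset _ _)).2 ⟨x, hx, ?_⟩
        simp
      have hcard := Finset.card_filter_add_card_filter_not (s := B) (fun x' => g i x' = g i x)
      have hcard' : ({x' ∈ B | g i x' = g i x}.card : ℝ) + (B'.card : ℝ) = B.card := by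
        exact_mod_cast hcard
      have hle : ∀ j ∈ (Finset.univ : Finset ι), ∑ y ∈ B'.image (g j), θ j y ≤
          ∑ y ∈ B.image (g j), θ j y := fun j _ =>
        Finset.sum_le_sum_of_subset_of_nonneg (Finset.image_subset_image hss.1)
          fun y _ _ => hθ j y
      have hi : ∑ y ∈ B'.image (g i), θ i y + θ i (g i x) ≤ ∑ y ∈ B.image (g i), θ i y := by
        rw [← Finset.sum_erase_add _ _ (Finset.mem_image_of_mem (g i) hx)]
        refine add_le_add (Finset.sum_le_sum_of_subset_of_nonneg ?_ fun y _ _ => hθ i y) le_rfl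
        intro y hy
        obtain ⟨x', hx', rfl⟩ := Finset.mem_image.1 hy
        rw [hB', Finset.mem_filter] at hx'
        exact Finset.mem_erase.2 ⟨hx'.2, Finset.mem_image_of_mem _ hx'.1⟩
      have htot : ∑ j, ∑ y ∈ B'.image (g j), θ j y + θ i (g i x) ≤
          ∑ j, ∑ y ∈ B.image (g j), θ j y := by
        rw [← Finset.add_sum_erase _ _ (Finset.mem_univ i),
          ← Finset.add_sum_erase _ (fun j => ∑ y ∈ B.image (g j), θ j y)
            (Finset.mem_univ i)]
        have := Finset.sum_le_sum fun j (hj : j ∈ Finset.univ.erase i) =>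
          hle j (Finset.mem_univ j)
        linarith
      obtain ⟨T, hT, hne, hfib⟩ := ih B' hss (by linarith)
      exact ⟨T, hT.trans hss.1, hne, hfib⟩

variable {V : Type*} {s : ℕ} {G : SimpleGraph V} {L : ℝ}

/-- A family of spiders with length vector `ℓ` which is closed under two operations: replacing a
spider by one with the same leaf vector whose other vertices avoid any given set of `N` vertices,
and moving a single leaf, for which there are at least `θ` choices. -/
structure Spider.Flexible (T : Set (Spider s G)) (ℓ : Fin s → ℕ) (N θ : ℕ) : Prop where
  hasLengths : ∀ S ∈ T, S.HasLengths ℓ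
  switch : ∀ S ∈ T, ∀ F : Finset V, F.card ≤ N →
    ∃ S' ∈ T, S'.leaf = S.leaf ∧ ∀ i a, a < ℓ i → S'.pt i a ∉ F
  move : ∀ S ∈ T, ∀ i, θ ≤ {y | ∃ S' ∈ T, S'.trunc (Function.update ℓ i (ℓ i - 1)) =
    S.trunc (Function.update ℓ i (ℓ i - 1)) ∧ S'.leaf i = y}.ncard

/-- Many admissible spiders which are not good give rise to a flexible family. -/
theorem Spider.exists_flexible [Fintype V] [DecidableRel G.Adj] (hs : 2 ≤ s) (hL : 1 ≤ L)
    (ℓ : Fin s → ℕ) (hℓ : ∀ i, 1 ≤ ℓ i) (N θ : ℕ)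
    (hN : 2 * ((N : ℝ) * (∑ i, ℓ i : ℕ)) ≤ L)
    (hθ : 2 * (s * (Fintype.card V * G.maxDegree ^ (∑ i, ℓ i - 1)) * θ) <
      {S : Spider s G | S.Admissible L ℓ ∧ ¬ S.Good L ℓ}.ncard) :
    ∃ T : Set (Spider s G), T.Nonempty ∧ Spider.Flexible T ℓ N θ := by
  classical
  have hpos : 1 ≤ ∑ a, ℓ a :=
    (hℓ ⟨0, by omega⟩).trans (Finset.single_le_sum (fun _ _ => Nat.zero_le _) (Finset.mem_univ _))
  have hf := one_le_spiderBound hL _ hpos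
  set Bad := {S : Spider s G | S.Admissible L ℓ ∧ ¬ S.Good L ℓ} with hBad
  have hfin : Bad.Finite := (finite_admissible ℓ).subset fun _ h => h.1
  set B := hfin.toFinset with hB
  have hmemB : ∀ {S}, S ∈ B ↔ S.Admissible L ℓ ∧ ¬ S.Good L ℓ := by
    intro S; rw [hB, Set.Finite.mem_toFinset]; rfl
  rw [Set.ncard_eq_toFinset_card _ hfin, ← hB] at hθ
  -- There are `s + 1` maps to clean: `none` stands for the leaf vector, `some i` for deleting the
  -- leaf of leg `i`.
  let β : Option (Fin s) → Type _ := fun o =>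
    match o with
    | none => Fin s → V
    | some _ => Spider s G
  let g : ∀ o : Option (Fin s), Spider s G → β o := fun o =>
    match o with
    | none => fun S => S.leaf
    | some i => fun S => S.trunc (Function.update ℓ i (ℓ i - 1))
  -- Thresholds: half of the original fibre for leaf vectors, which add up to half of `B`, and `θ`
  -- for each truncated spider. The latter add up to less than the other half by `hθ`.
  let τ : ∀ o : Option (Fin s), β o → ℝ := fun o =>
    match o with
    | none => fun v => ({S ∈ B | S.leaf = v}.card : ℝ) / 2
    | some _ => fun _ => (θ : ℝ)
  have hτ : ∀ o y, 0 ≤ τ o y := by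
    rintro (_ | i) y
    · change 0 ≤ ({S ∈ B | S.leaf = y}.card : ℝ) / 2
      positivity
    · change (0 : ℝ) ≤ θ
      positivity
  have : ∀ o, DecidableEq (β o) := fun o => Classical.decEq _
  have hsum : ∑ o, ∑ y ∈ B.image (g o), τ o y < B.card := by
    rw [Fintype.sum_option]
    have h1 : ∑ y ∈ B.image (g none), τ none y = (B.card : ℝ) / 2 := by
      have h0 : ∑ v ∈ B.image Spider.leaf, ({S ∈ B | S.leaf = v}.card : ℝ) / 2 =
          (B.card : ℝ) / 2 := by
        rw [← Finset.sum_div]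
        congr 1
        exact_mod_cast (Finset.card_eq_sum_card_image Spider.leaf B).symm
      convert h0
    have h2 : ∀ i : Fin s, ∑ y ∈ B.image (g (some i)), τ (some i) y ≤
        ((Fintype.card V * G.maxDegree ^ (∑ i, ℓ i - 1) : ℕ) : ℝ) * θ := by
      intro i
      have h0 : ∀ y, τ (some i) y = θ := fun _ => rfl
      simp only [h0]
      rw [Finset.sum_const, nsmul_eq_mul]
      refine mul_le_mul_of_nonneg_right (Nat.cast_le.2 ?_) (Nat.cast_nonneg θ)
      set ℓ' := Function.update ℓ i (ℓ i - 1) with hℓ'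
      have hsum' : ∑ a, ℓ' a = ∑ a, ℓ a - 1 := by
        have h1 := Finset.add_sum_erase Finset.univ ℓ (Finset.mem_univ i)
        have h2 := Finset.add_sum_erase Finset.univ ℓ' (Finset.mem_univ i)
        have h3 : ∑ x ∈ Finset.univ.erase i, ℓ' x = ∑ x ∈ Finset.univ.erase i, ℓ x :=
          Finset.sum_congr rfl fun x hx => by simp [hℓ', Finset.ne_of_mem_erase hx]
        have h4 : ℓ' i = ℓ i - 1 := by simp [hℓ']
        have := hℓ i
        omega
      rw [← hsum', ← Set.ncard_coe_finset]
      refine le_trans (Set.ncard_le_ncard ?_ (finite_hasLengths ℓ')) (ncard_hasLengths_le ℓ')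
      intro R hR
      rw [Finset.mem_coe, Finset.mem_image] at hR
      obtain ⟨S, hS, rfl⟩ := hR
      exact (hmemB.1 hS).1.hasLengths.trunc (update_pred_le ℓ i (Nat.sub_le _ _))
    have h3 := Finset.sum_le_sum fun i (_ : i ∈ (Finset.univ : Finset (Fin s))) => h2 i
    rw [Finset.sum_const, Finset.card_univ, Fintype.card_fin, nsmul_eq_mul] at h3
    have h4 : (2 : ℝ) * (s * ((Fintype.card V * G.maxDegree ^ (∑ i, ℓ i - 1) : ℕ) : ℝ) * θ) <
        B.card := by exact_mod_cast hθ
    refine lt_of_le_of_lt (add_le_add (show _ ≤ (B.card : ℝ) / 2 from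
        le_trans (le_of_eq (by congr!)) h1.le)
      (show _ ≤ (s : ℝ) * (((Fintype.card V * G.maxDegree ^ (∑ i, ℓ i - 1) : ℕ) : ℝ) * θ) from
        le_trans (le_of_eq (by congr!)) h3)) ?_
    linarith
  obtain ⟨T, hTB, hne, hT⟩ := exists_subset_le_card_fibers g τ hτ B hsum
  refine ⟨T, hne, fun S hS => (hmemB.1 (hTB hS)).1.hasLengths, ?_, ?_⟩
  · intro S hS F hF
    have hSB := hmemB.1 (hTB hS)
    have h1 : ({S' ∈ B | S'.leaf = S.leaf}.card : ℝ) / 2 ≤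
        ({S' ∈ T | S'.leaf = S.leaf}.card : ℝ) := by convert hT none S hS
    -- Among admissible spiders, being good depends only on the leaf vector, so every admissible
    -- spider with the leaves of `S` is bad and lies in `B`.
    have h2 : spiderBound L (∑ a, ℓ a) < ({S' ∈ B | S'.leaf = S.leaf}.card : ℝ) := by
      have hng := hSB.2
      rw [Good, not_and, not_le] at hng
      refine lt_of_lt_of_le (hng hSB.1) ?_
      rw [← Set.ncard_coe_finset]
      have : {S' : Spider s G | S'.Admissible L ℓ ∧ S'.leaf = S.leaf} ⊆
          (↑({S' ∈ B | S'.leaf = S.leaf} : Finset (Spider s G)) : Set (Spider s G)) := by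
        rintro S' ⟨hS', hl⟩
        rw [Finset.mem_coe, Finset.mem_filter]
        refine ⟨hmemB.2 ⟨hS', fun hg => hSB.2 ⟨hSB.1, ?_⟩⟩, hl⟩
        rw [← hl]
        exact hg.2
      exact_mod_cast Set.ncard_le_ncard this (Finset.finite_toSet _)
    -- If every spider of `T` with these leaves met `F`, there would be at most `N m f / L ≤ f / 2`
    -- of them, with `m` the total length and `f = f(m, L)`; but there are more than `f / 2`.
    by_contra! hcon
    have h3 := ncard_through_finset_le (G := G) hs hL ℓ hℓ S.leaf F
    have h4 : ({S' ∈ T | S'.leaf = S.leaf}.card : ℝ) ≤ ({S' : Spider s G | S'.Admissible L ℓ ∧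
        S'.leaf = S.leaf ∧ ∃ i a, a < ℓ i ∧ S'.pt i a ∈ F}.ncard : ℝ) := by
      rw [← Set.ncard_coe_finset]
      have : (↑({S' ∈ T | S'.leaf = S.leaf} : Finset (Spider s G)) : Set (Spider s G)) ⊆
          {S' : Spider s G | S'.Admissible L ℓ ∧
            S'.leaf = S.leaf ∧ ∃ i a, a < ℓ i ∧ S'.pt i a ∈ F} := by
        intro S' hS'
        rw [Finset.mem_coe, Finset.mem_filter] at hS'
        exact ⟨(hmemB.1 (hTB hS'.1)).1, hS'.2, hcon S' hS'.1 hS'.2⟩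
      exact_mod_cast Set.ncard_le_ncard this
        ((finite_admissible (G := G) (L := L) ℓ).subset fun _ h => h.1)
    have h5 : (F.card : ℝ) * (∑ i, ℓ i : ℕ) * spiderBound L (∑ a, ℓ a) ≤
        N * (∑ i, ℓ i : ℕ) * spiderBound L (∑ a, ℓ a) := by
      gcongr
    push_cast at h5 hN
    have h6 : L * ({S' ∈ T | S'.leaf = S.leaf}.card : ℝ) ≤
        L * (spiderBound L (∑ a, ℓ a) / 2) := by
      calc _ ≤ L * ({S' : Spider s G | S'.Admissible L ℓ ∧
        S'.leaf = S.leaf ∧ ∃ i a, a < ℓ i ∧ S'.pt i a ∈ F}.ncard : ℝ) := by gcongr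
        _ ≤ N * (∑ i, (ℓ i : ℝ)) * spiderBound L (∑ a, ℓ a) := by push_cast at h3; linarith
        _ ≤ (L / 2) * spiderBound L (∑ a, ℓ a) := by gcongr; linarith
        _ = _ := by ring
    have h7 := le_of_mul_le_mul_left h6 (by linarith)
    linarith
  · intro S hS i
    have h1 : (θ : ℝ) ≤ ({S' ∈ T | S'.trunc (Function.update ℓ i (ℓ i - 1)) =
        S.trunc (Function.update ℓ i (ℓ i - 1))}.card : ℝ) := by convert hT (some i) S hS
    have h2 : θ ≤ ({S' ∈ T | S'.trunc (Function.update ℓ i (ℓ i - 1)) =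
        S.trunc (Function.update ℓ i (ℓ i - 1))}.card) := by exact_mod_cast h1
    refine h2.trans ?_
    rw [← Set.ncard_coe_finset]
    refine Set.ncard_le_ncard_of_injOn (fun S' => S'.leaf i) ?_ ?_ (Set.toFinite _)
    · intro S' hS'
      rw [Finset.mem_coe, Finset.mem_filter] at hS'
      exact ⟨S', hS'.1, hS'.2, rfl⟩
    · intro S₁ h₁ S₂ h₂ he
      rw [Finset.mem_coe, Finset.mem_filter] at h₁ h₂
      exact (hmemB.1 (hTB h₁.1)).1.hasLengths.ext_of_trunc (hmemB.1 (hTB h₂.1)).1.hasLengths i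
        (h₁.2.trans h₂.2.symm) he

end Cleaning

/-! ### Assembling the subdivided `K_{s,t}` from systems of paths. -/

section Embedding

open Finset

variable {V : Type*} {s t k : ℕ} {G : SimpleGraph V}

theorem subdividedCompleteBipartite_isContained (φ : SubdivVertex s t k → V)
    (hφ : Function.Injective φ)
    (hadj : ∀ i j a, a < k →
      G.Adj (φ (subdivPoint s t k i j a)) (φ (subdivPoint s t k i j (a + 1)))) :
    (subdividedCompleteBipartite s t k).IsContained G := by
  refine ⟨⟨⟨φ, ?_⟩, hφ⟩⟩
  intro u v huv
  rw [subdividedCompleteBipartite, SimpleGraph.fromRel_adj] at huv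
  rcases huv.2 with ⟨i, j, a, ha, rfl, rfl⟩ | ⟨i, j, a, ha, rfl, rfl⟩
  · exact hadj i j a ha
  · exact (hadj i j a ha).symm

/-- Paths `q i` of length `k` from `x i` to a common endpoint, which are disjoint apart from this
endpoint and which avoid `F` except possibly at the vertices `x i`. -/
structure MeetingPaths (G : SimpleGraph V) (k : ℕ) (x : Fin s → V) (F : Finset V)
    (q : Fin s → ℕ → V) : Prop where
  start : ∀ i, q i 0 = x i
  meet : ∀ i j, q i k = q j k
  adj : ∀ i a, a < k → G.Adj (q i a) (q i (a + 1))
  inj : ∀ i j a b, a ≤ k → b ≤ k → q i a = q j b → (a = k ∧ b = k) ∨ (i = j ∧ a = b)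
  avoid : ∀ i a, 1 ≤ a → a ≤ k → q i a ∉ F

/-- Choose `t` systems greedily, each avoiding the `x i` and all earlier systems. The `x i` become
one side of `K_{s,t}`, and the meeting points of the systems the other. -/
theorem isContained_of_meetingPaths (hs : 0 < s) (hk : 1 ≤ k) (x : Fin s → V)
    (hx : Function.Injective x) (N : ℕ) (hN : s + t * (s * (k + 1)) ≤ N)
    (hq : ∀ F : Finset V, F.card ≤ N → ∃ q, MeetingPaths G k x F q) :
    (subdividedCompleteBipartite s t k).IsContained G := by
  classical
  set X : Finset V := Finset.univ.image x with hX
  have hXcard : X.card ≤ s := Finset.card_image_le.trans (by simp)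
  have hseq : ∀ m ≤ t, ∃ Q : ℕ → Fin s → ℕ → V, (∀ j < m, MeetingPaths G k x X (Q j)) ∧
      ∀ j < m, ∀ j' < j, ∀ i i' a b, 1 ≤ a → a ≤ k → b ≤ k → Q j i a ≠ Q j' i' b := by
    intro m
    induction m with
    | zero => exact fun _ => ⟨fun _ i _ => x i, by simp, by simp⟩
    | succ m ih =>
      intro hm
      obtain ⟨Q, hQ, hdisj⟩ := ih (by omega)
      set F : Finset V := X ∪ ((Finset.range m) ×ˢ
        ((Finset.univ : Finset (Fin s)) ×ˢ Finset.range (k + 1))).image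
          (fun p => Q p.1 p.2.1 p.2.2) with hF
      have hFcard : F.card ≤ N := by
        refine (Finset.card_union_le _ _).trans ?_
        have h1 : (((Finset.range m) ×ˢ
          ((Finset.univ : Finset (Fin s)) ×ˢ Finset.range (k + 1))).image
            (fun p => Q p.1 p.2.1 p.2.2)).card ≤ m * (s * (k + 1)) :=
          Finset.card_image_le.trans (by simp)
        have h2 : m * (s * (k + 1)) ≤ t * (s * (k + 1)) := Nat.mul_le_mul_right _ (by omega)
        omega
      obtain ⟨q, hq⟩ := hq F hFcard
      refine ⟨Function.update Q m q, ?_, ?_⟩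
      · intro j hj
        rcases Nat.lt_succ_iff_lt_or_eq.1 hj with hj | rfl
        · rw [Function.update_of_ne hj.ne]
          exact hQ j hj
        · rw [Function.update_self]
          exact ⟨hq.start, hq.meet, hq.adj, hq.inj, fun i a h1 h2 h3 =>
            hq.avoid i a h1 h2 (Finset.mem_union_left _ h3)⟩
      · intro j hj j' hj' i i' a b h1 h2 h3
        rw [Function.update_of_ne (by omega : j' ≠ m)]
        rcases Nat.lt_succ_iff_lt_or_eq.1 hj with hj | rfl
        · rw [Function.update_of_ne hj.ne]
          exact hdisj j hj j' hj' i i' a b h1 h2 h3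
        · rw [Function.update_self]
          intro he
          refine hq.avoid i a h1 h2 (he ▸ Finset.mem_union_right _ ?_)
          exact Finset.mem_image.2 ⟨(j', i', b), by simp; omega, rfl⟩
  obtain ⟨Q, hQ, hdisj⟩ := hseq t le_rfl
  have hxX : ∀ i, x i ∈ X := fun i => Finset.mem_image_of_mem x (Finset.mem_univ i)
  have hne : ∀ j j' : Fin t, j ≠ j' → ∀ i i' a b, 1 ≤ a → a ≤ k → 1 ≤ b → b ≤ k →
      Q j i a ≠ Q j' i' b := by
    intro j j' hj i i' a b h1 h2 h3 h4
    rcases lt_or_gt_of_ne (Fin.val_ne_of_ne hj) with h | h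
    · exact (hdisj j' j'.2 j h i' i b a h3 h4 h2).symm
    · exact hdisj j j.2 j' h i i' a b h1 h2 h4
  set i₀ : Fin s := ⟨0, hs⟩
  set φ : SubdivVertex s t k → V := fun u =>
    match u with
    | Sum.inl (Sum.inl i) => x i
    | Sum.inl (Sum.inr j) => Q j i₀ k
    | Sum.inr (i, j, a) => Q j i (a + 1) with hφ
  have hpt : ∀ i j a, a ≤ k → φ (subdivPoint s t k i j a) = Q j i a := by
    intro i j a ha
    unfold subdivPoint
    split_ifs with h1 h2
    · rw [h1]
      exact ((hQ j j.2).start i).symm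
    · change Q j i (a - 1 + 1) = Q j i a
      rw [Nat.sub_add_cancel (by omega)]
    · obtain rfl : a = k := by omega
      exact (hQ j j.2).meet i₀ i
  have hxQ : ∀ i (j : Fin t) i' a, 1 ≤ a → a ≤ k → x i ≠ Q j i' a := fun i j i' a h1 h2 he =>
    (hQ j j.2).avoid i' a h1 h2 (he ▸ hxX i)
  refine subdividedCompleteBipartite_isContained φ ?_ ?_
  · have hcQ : ∀ (j j' : Fin t) i (a : Fin (k - 1)), Q j i₀ k ≠ Q j' i (a + 1) := by
      intro j j' i a he
      have ha := a.2
      by_cases hj : j = j'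
      · subst hj
        rcases (hQ j j.2).inj _ _ _ _ le_rfl (by omega) he with h | h <;> omega
      · exact hne j j' hj _ _ _ _ hk le_rfl (by omega) (by omega) he
    rintro ((i | j) | ⟨i, j, a⟩) ((i' | j') | ⟨i', j', a'⟩) he <;> simp only [hφ] at he
    · rw [hx he]
    · exact absurd he (hxQ _ _ _ _ hk le_rfl)
    · exact absurd he (hxQ _ _ _ _ (by omega) (by omega))
    · exact absurd he.symm (hxQ _ _ _ _ hk le_rfl)
    · by_cases hj : j = j'
      · rw [hj]
      · exact absurd he (hne j j' hj _ _ _ _ hk le_rfl hk le_rfl)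
    · exact absurd he (hcQ _ _ _ _)
    · exact absurd he.symm (hxQ _ _ _ _ (by omega) (by omega))
    · exact absurd he.symm (hcQ _ _ _ _)
    · have ha := a.2
      have ha' := a'.2
      by_cases hj : j = j'
      · subst hj
        rcases (hQ j j.2).inj _ _ _ _ (by omega) (by omega) he with h | h
        · omega
        · obtain ⟨rfl, h⟩ := h
          obtain rfl : a = a' := Fin.ext (by omega)
          rfl
      · exact absurd he (hne j j' hj _ _ _ _ (by omega) (by omega) (by omega) (by omega))
  · intro i j a ha
    rw [hpt i j a ha.le, hpt i j (a + 1) ha]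
    exact (hQ j j.2).adj i a ha

end Embedding

/-! ### Lengthening tails two edges at a time. -/

section Zigzag

open Finset

variable {V : Type*} {s k : ℕ} {G : SimpleGraph V} {T : Set (Spider s G)} {ℓ : Fin s → ℕ}
  {N θ : ℕ}

/-- A spider `S ∈ T` together with disjoint paths `e i`, of length `d i`, from `x i` to the `i`th
leaf of `S`, which avoid `F` except possibly at the vertices `x i`. -/
structure LeafPaths (T : Set (Spider s G)) (x : Fin s → V) (F : Finset V) (d : Fin s → ℕ)
    (S : Spider s G) (e : Fin s → ℕ → V) : Prop where
  mem : S ∈ T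
  start : ∀ i, e i 0 = x i
  finish : ∀ i, e i (d i) = S.leaf i
  adj : ∀ i a, a < d i → G.Adj (e i a) (e i (a + 1))
  inj : ∀ i j a b, a ≤ d i → b ≤ d j → e i a = e j b → i = j ∧ a = b
  avoid : ∀ i a, 1 ≤ a → a ≤ d i → e i a ∉ F

/-- There are more choices for leaf `i` than vertices in `F`. The position `ℓ j - 1` is still
covered by the truncation, so the neighbours of all leaves stay put. -/
theorem Spider.Flexible.exists_move [Finite V] (hT : Spider.Flexible T ℓ N θ) (hθ : N < θ)
    {S : Spider s G} (hS : S ∈ T) (i : Fin s) {F : Finset V} (hF : F.card ≤ N) :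
    ∃ S' ∈ T, S'.leaf i ∉ F ∧ (∀ j, j ≠ i → S'.leaf j = S.leaf j) ∧
      ∀ j, S'.pt j (ℓ j - 1) = S.pt j (ℓ j - 1) := by
  classical
  have h := hT.move S hS i
  obtain ⟨y, ⟨S', hS', htr, rfl⟩, hy⟩ := Set.exists_mem_notMem_of_ncard_lt_ncard
    (s := (F : Set V)) (lt_of_lt_of_le (by rw [Set.ncard_coe_finset]; omega) h)
    (Finset.finite_toSet F)
  refine ⟨S', hS', by simpa using hy, fun j hj => ?_, fun j => ?_⟩
  · rw [← (hT.hasLengths S hS).pt_eq_leaf j, ← (hT.hasLengths S' hS').pt_eq_leaf j]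
    exact Spider.pt_eq_of_trunc_eq htr (by simp [hj])
  · refine Spider.pt_eq_of_trunc_eq htr ?_
    by_cases hj : j = i
    · subst hj; simp
    · simp [hj]

/-- The vertices of a system of paths. -/
def pathVertices [DecidableEq V] (d : Fin s → ℕ) (e : Fin s → ℕ → V) : Finset V :=
  Finset.univ.biUnion fun i => (Finset.range (d i + 1)).image (e i)

theorem mem_pathVertices [DecidableEq V] {d : Fin s → ℕ} (e : Fin s → ℕ → V) {i : Fin s} {a : ℕ}
    (ha : a ≤ d i) : e i a ∈ pathVertices d e :=
  Finset.mem_biUnion.2 ⟨i, Finset.mem_univ i,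
    Finset.mem_image_of_mem _ (Finset.mem_range.2 (by omega))⟩

theorem card_pathVertices_le [DecidableEq V] (d : Fin s → ℕ) (e : Fin s → ℕ → V) :
    (pathVertices d e).card ≤ ∑ i, (d i + 1) := by
  refine Finset.card_biUnion_le.trans (Finset.sum_le_sum fun i _ => ?_)
  exact Finset.card_image_le.trans (by simp)

/-- One zigzag: take a fresh spider with the same leaves, walk from leaf `i` back to its neighbour
`p` on the leg, then out to a new leaf `y`. Moving the leaf keeps `p`, so both edges exist and the
new spider ends at `y`. -/
theorem LeafPaths.step [Finite V] (hT : Spider.Flexible T ℓ N θ) (hθ : N < θ)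
    (hℓ : ∀ i, 1 ≤ ℓ i) {x : Fin s → V} {F : Finset V} {d : Fin s → ℕ} {S : Spider s G}
    {e : Fin s → ℕ → V} (h : LeafPaths T x F d S e) (hN : F.card + ∑ i, (d i + 1) ≤ N)
    (i : Fin s) : ∃ S' e', LeafPaths T x F (Function.update d i (d i + 2)) S' e' := by
  classical
  set W := F ∪ pathVertices d e with hW
  have hWcard : W.card ≤ N := (Finset.card_union_le _ _).trans
    ((Nat.add_le_add_left (card_pathVertices_le d e) _).trans hN)
  obtain ⟨S₁, hS₁, hl₁, hav₁⟩ := hT.switch S h.mem W hWcard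
  obtain ⟨S₂, hS₂, hy, hl₂, hp₂⟩ := hT.exists_move hθ hS₁ i hWcard
  have hp : S₁.pt i (ℓ i - 1) ∉ W := hav₁ i _ (by have := hℓ i; omega)
  have hadj₁ : G.Adj (S₁.pt i (ℓ i - 1)) (S₁.leaf i) := by
    have := (hT.hasLengths S₁ hS₁).adj (i := i) (a := ℓ i - 1) (by have := hℓ i; omega)
    rwa [Nat.sub_add_cancel (hℓ i), (hT.hasLengths S₁ hS₁).pt_eq_leaf] at this
  have hadj₂ : G.Adj (S₁.pt i (ℓ i - 1)) (S₂.leaf i) := by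
    have := (hT.hasLengths S₂ hS₂).adj (i := i) (a := ℓ i - 1) (by have := hℓ i; omega)
    rwa [Nat.sub_add_cancel (hℓ i), (hT.hasLengths S₂ hS₂).pt_eq_leaf, hp₂] at this
  set p := S₁.pt i (ℓ i - 1) with hpdef
  set y := S₂.leaf i with hydef
  have hpy : p ≠ y := hadj₂.ne
  have hU : ∀ j a, a ≤ d j → e j a ∈ W := fun j a ha =>
    Finset.mem_union_right _ (mem_pathVertices e ha)
  have hF : ∀ z ∈ F, z ∈ W := fun z hz => Finset.mem_union_left _ hz
  set f : ℕ → V := fun a => if a ≤ d i then e i a else if a = d i + 1 then p else y with hf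
  have hf0 : ∀ a, a ≤ d i → f a = e i a := fun a ha => by simp [hf, ha]
  have hf1 : f (d i + 1) = p := by simp [hf]
  have hf2 : f (d i + 2) = y := by simp [hf]
  have hcases : ∀ a, a ≤ d i + 2 → a ≤ d i ∨ a = d i + 1 ∨ a = d i + 2 := by omega
  refine ⟨S₂, Function.update e i f, hS₂, ?_, ?_, ?_, ?_, ?_⟩
  · intro j
    by_cases hj : j = i
    · subst hj; rw [Function.update_self, hf0 0 (Nat.zero_le _), h.start]
    · rw [Function.update_of_ne hj, h.start]
  · intro j
    by_cases hj : j = i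
    · subst hj; rw [Function.update_self, Function.update_self, hf2]
    · rw [Function.update_of_ne hj, Function.update_of_ne hj, h.finish, hl₂ j hj, hl₁]
  · intro j a ha
    by_cases hj : j = i
    · subst hj
      rw [Function.update_self] at ha ⊢
      rcases hcases a ha.le with h1 | rfl | rfl
      · rcases Nat.lt_or_ge a (d j) with h2 | h2
        · rw [hf0 a h1, hf0 (a + 1) h2]
          exact h.adj j a h2
        · obtain rfl : a = d j := le_antisymm h1 h2
          rw [hf0 _ le_rfl, hf1, h.finish, ← hl₁]
          exact hadj₁.symm
      · rw [hf1, hf2]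
        exact hadj₂
      · omega
    · rw [Function.update_of_ne hj] at ha ⊢
      exact h.adj j a ha
  · have hother : ∀ j b a, j ≠ i → b ≤ d j → a ≤ d i + 2 → f a ≠ e j b := by
      intro j b a hj hb ha he
      rcases hcases a ha with h1 | rfl | rfl
      · rw [hf0 a h1] at he
        exact hj (h.inj _ _ _ _ h1 hb he).1.symm
      · exact hp (hf1 ▸ he ▸ hU j b hb)
      · exact hy (hf2 ▸ he ▸ hU j b hb)
    intro j j' a b ha hb he
    by_cases hj : j = i
    · subst hj
      by_cases hj' : j' = j
      · subst hj'
        simp only [Function.update_self] at ha hb he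
        refine ⟨rfl, ?_⟩
        rcases hcases a ha with h1 | rfl | rfl <;> rcases hcases b hb with h2 | rfl | rfl <;>
          try simp only [hf1, hf2] at he
        · rw [hf0 a h1, hf0 b h2] at he
          exact (h.inj _ _ _ _ h1 h2 he).2
        · rw [hf0 a h1] at he
          exact absurd (he ▸ hU _ a h1) hp
        · rw [hf0 a h1] at he
          exact absurd (he ▸ hU _ a h1) hy
        · rw [hf0 b h2] at he
          exact absurd (he ▸ hU _ b h2) hp
        · rfl
        · exact absurd he hpy
        · rw [hf0 b h2] at he
          exact absurd (he ▸ hU _ b h2) hy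
        · exact absurd he.symm hpy
        · rfl
      · rw [Function.update_self] at ha he
        rw [Function.update_of_ne hj'] at hb he
        exact absurd he (hother j' b a hj' hb ha)
    · rw [Function.update_of_ne hj] at ha he
      by_cases hj' : j' = i
      · subst hj'
        rw [Function.update_self] at hb he
        exact absurd he.symm (hother j a b hj ha hb)
      · rw [Function.update_of_ne hj'] at hb he
        exact h.inj _ _ _ _ ha hb he
  · intro j a h1 ha
    by_cases hj : j = i
    · subst hj
      rw [Function.update_self] at ha ⊢
      rcases hcases a ha with h2 | rfl | rfl
      · rw [hf0 a h2]
        exact h.avoid j a h1 h2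
      · rw [hf1]
        exact fun hm => hp (hF _ hm)
      · rw [hf2]
        exact fun hm => hy (hF _ hm)
    · rw [Function.update_of_ne hj] at ha ⊢
      exact h.avoid j a h1 ha

theorem LeafPaths.extend [Finite V] (hT : Spider.Flexible T ℓ N θ) (hθ : N < θ)
    (hℓ : ∀ i, 1 ≤ ℓ i) {x : Fin s → V} {F : Finset V} {r : Fin s → ℕ}
    (hN : F.card + ∑ i, (r i + 1) ≤ N) {d : Fin s → ℕ} {S : Spider s G} {e : Fin s → ℕ → V}
    (h : LeafPaths T x F d S e) (hd : ∀ i, ∃ m, d i + 2 * m = r i) :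
    ∃ S' e', LeafPaths T x F r S' e' := by
  classical
  induction hn : ∑ i, (r i - d i) using Nat.strong_induction_on generalizing d S e with
  | _ n ih =>
    by_cases heq : d = r
    · subst heq
      exact ⟨S, e, h⟩
    · obtain ⟨i, hi⟩ := Function.ne_iff.1 heq
      obtain ⟨m, hm⟩ := hd i
      have hle : ∀ j, d j ≤ r j := fun j => by obtain ⟨m, hm⟩ := hd j; omega
      have hsum : ∑ j, (d j + 1) ≤ ∑ j, (r j + 1) :=
        Finset.sum_le_sum fun j _ => Nat.add_le_add_right (hle j) 1
      obtain ⟨S', e', h'⟩ := h.step hT hθ hℓ (by omega) i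
      refine ih _ ?_ h' ?_ rfl
      · rw [← hn]
        refine Finset.sum_lt_sum (fun j _ => ?_) ⟨i, Finset.mem_univ i, ?_⟩
        · by_cases hj : j = i
          · subst hj; rw [Function.update_self]; omega
          · rw [Function.update_of_ne hj]
        · rw [Function.update_self]; omega
      · intro j
        by_cases hj : j = i
        · subst hj
          rw [Function.update_self]
          exact ⟨m - 1, by omega⟩
        · rw [Function.update_of_ne hj]
          exact hd j

/-- A last fresh spider, avoiding `F` and all tails, is attached at its leaves. Its legs are
traversed backwards, so position `a` on path `i` is at distance `k - a` from the centre. -/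
theorem LeafPaths.exists_meetingPaths (hT : Spider.Flexible T ℓ N θ)
    (hℓ : ∀ i, 1 ≤ ℓ i) {x : Fin s → V} {F : Finset V} {r : Fin s → ℕ}
    (hr : ∀ i, r i + ℓ i = k) (hN : F.card + ∑ i, (r i + 1) ≤ N) {S : Spider s G}
    {e : Fin s → ℕ → V} (h : LeafPaths T x F r S e) : ∃ q, MeetingPaths G k x F q := by
  classical
  set W := F ∪ pathVertices r e with hW
  have hWcard : W.card ≤ N := (Finset.card_union_le _ _).trans
    ((Nat.add_le_add_left (card_pathVertices_le r e) _).trans hN)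
  obtain ⟨S₁, hS₁, hl₁, hav⟩ := hT.switch S h.mem W hWcard
  have hlen := hT.hasLengths S₁ hS₁
  have hU : ∀ j a, a ≤ r j → e j a ∈ W := fun j a ha =>
    Finset.mem_union_right _ (mem_pathVertices e ha)
  set q : Fin s → ℕ → V := fun i a => if a ≤ r i then e i a else S₁.pt i (k - a) with hq
  have hq0 : ∀ i a, a ≤ r i → q i a = e i a := fun i a ha => by simp [hq, ha]
  have hq1 : ∀ i a, r i < a → q i a = S₁.pt i (k - a) := fun i a ha => by
    simp [hq, not_le.2 ha]
  have hqend : ∀ i, q i k = S₁.centre := fun i => by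
    rw [hq1 i k (by have := hr i; have := hℓ i; omega), Nat.sub_self, Spider.pt_zero]
  refine ⟨q, fun i => by rw [hq0 i 0 (Nat.zero_le _), h.start], fun i j => by rw [hqend, hqend],
    ?_, ?_, ?_⟩
  · intro i a ha
    have hri := hr i
    rcases lt_trichotomy a (r i) with h1 | h1 | h1
    · rw [hq0 i a h1.le, hq0 i (a + 1) h1]
      exact h.adj i a h1
    · rw [hq0 i a h1.le, hq1 i (a + 1) (by omega), h1, h.finish, ← hl₁, ← hlen.pt_eq_leaf]
      have := hlen.adj (i := i) (a := k - (r i + 1)) (by omega)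
      rw [show k - (r i + 1) + 1 = ℓ i by omega] at this
      exact this.symm
    · rw [hq1 i a h1, hq1 i (a + 1) (by omega)]
      have := hlen.adj (i := i) (a := k - (a + 1)) (by omega)
      rw [show k - (a + 1) + 1 = k - a by omega] at this
      exact this.symm
  · intro i j a b ha hb he
    have hri := hr i
    have hrj := hr j
    rcases Nat.lt_or_ge (r i) a with h1 | h1 <;> rcases Nat.lt_or_ge (r j) b with h2 | h2
    · rw [hq1 i a h1, hq1 j b h2] at he
      rcases hlen.pt_inj (by omega) (by omega) he with h3 | ⟨h3, h4⟩
      · left; omega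
      · exact Or.inr ⟨h3, by omega⟩
    · rw [hq1 i a h1, hq0 j b h2] at he
      exact absurd (he ▸ hU j b h2) (hav i (k - a) (by omega))
    · rw [hq0 i a h1, hq1 j b h2] at he
      exact absurd (he ▸ hU i a h1) (hav j (k - b) (by omega))
    · rw [hq0 i a h1, hq0 j b h2] at he
      exact Or.inr (h.inj _ _ _ _ h1 h2 he)
  · intro i a h1 ha
    have hri := hr i
    rcases Nat.lt_or_ge (r i) a with h2 | h2
    · rw [hq1 i a h2]
      exact fun hm => hav i (k - a) (by omega) (Finset.mem_union_left _ hm)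
    · rw [hq0 i a h2]
      exact h.avoid i a h1 h2

/-- In a flexible family, leaves can be moved simultaneously out of a small set, keeping their
neighbours in the spider. -/
theorem Spider.Flexible.exists_move_finset [Finite V] (hT : Spider.Flexible T ℓ N θ)
    (hθ : N < θ) {S₀ : Spider s G} (hS₀ : S₀ ∈ T) {F : Finset V} (hF : F.card ≤ N)
    (J : Finset (Fin s)) :
    ∃ S ∈ T, (∀ i, S.pt i (ℓ i - 1) = S₀.pt i (ℓ i - 1)) ∧ (∀ i ∉ J, S.leaf i = S₀.leaf i) ∧
      ∀ i ∈ J, S.leaf i ∉ F := by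
  classical
  induction J using Finset.induction_on with
  | empty => exact ⟨S₀, hS₀, by simp⟩
  | insert i J hi ih =>
    obtain ⟨S, hS, h1, h2, h3⟩ := ih
    obtain ⟨S', hS', h4, h5, h6⟩ := hT.exists_move hθ hS i hF
    refine ⟨S', hS', fun j => (h6 j).trans (h1 j), ?_, ?_⟩
    · intro j hj
      rw [Finset.mem_insert, not_or] at hj
      rw [h5 j hj.1, h2 j hj.2]
    · intro j hj
      by_cases hji : j = i
      · rwa [hji]
      · rw [h5 j hji]
        exact h3 j (Finset.mem_of_mem_insert_of_ne hj hji)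

/-- A flexible family of spiders yields a copy of the subdivided complete bipartite graph, unless
`k` is even and two legs have length one. -/
theorem Spider.Flexible.isContained_of_zigzag [Finite V] {t : ℕ} (hs : 0 < s) (hk : 1 ≤ k)
    (hℓ : ∀ i, 1 ≤ ℓ i ∧ ℓ i ≤ k) (hpar : ∀ i j, ℓ i = 1 → ℓ j = 1 → Even k → i = j)
    (hN : s + t * (s * (k + 1)) + s * (k + 1) ≤ N) (hθ : N < θ)
    (hT : Spider.Flexible T ℓ N θ) (hne : T.Nonempty) :
    (subdividedCompleteBipartite s t k).IsContained G := by
  classical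
  obtain ⟨S₀, hS₀⟩ := hne
  -- Zigzags preserve the parity of the tail length, so leg `i` starts with a tail of length `0` or
  -- `1`, according to the parity of `k - ℓ i`.
  set ρ : Fin s → ℕ := fun i => (k - ℓ i) % 2 with hρ
  have hρ1 : ∀ i, ρ i ≤ 1 := fun i => by simp only [hρ]; omega
  set x : Fin s → V := fun i => S₀.pt i (ℓ i - ρ i) with hx
  -- Initial tails on different legs can only meet at the centre. This forces both legs to have
  -- length `1` and `k - 1` to be odd, which `hpar` excludes.
  have hinj : ∀ i j a b, a ≤ ρ i → b ≤ ρ j →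
      (ℓ i - ρ i + a = 0 ∧ ℓ j - ρ j + b = 0) ∨ (i = j ∧ ℓ i - ρ i + a = ℓ j - ρ j + b) →
      i = j ∧ a = b := by
    intro i j a b ha hb h
    have hi := hℓ i
    have hj := hℓ j
    have hρi := hρ1 i
    have hρj := hρ1 j
    rcases h with h | ⟨rfl, h⟩
    · refine ⟨hpar i j (by omega) (by omega) ?_, by omega⟩
      have : (k - ℓ i) % 2 = 1 := by
        have : ρ i = 1 := by omega
        simpa only [hρ] using this
      rw [Nat.even_iff]
      omega
    · exact ⟨rfl, by omega⟩
  refine isContained_of_meetingPaths hs hk x ?_ _ le_rfl ?_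
  · intro i j hij
    have h := (hT.hasLengths S₀ hS₀).pt_inj (Nat.sub_le _ _) (Nat.sub_le _ _) hij
    exact (hinj i j 0 0 (Nat.zero_le _) (Nat.zero_le _) (by simpa using h)).1
  · intro F hF
    set r : Fin s → ℕ := fun i => k - ℓ i with hr
    have hsum : ∑ i, (r i + 1) ≤ s * (k + 1) := by
      calc ∑ i, (r i + 1) ≤ ∑ _i : Fin s, (k + 1) :=
            Finset.sum_le_sum fun i _ => by simp only [hr]; omega
        _ = _ := by simp
    -- The `x i` must not depend on `F`, but a tail of length `1` ends at a leaf which has to avoid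
    -- `F`; only these leaves are moved, their neighbours `x i` being kept.
    obtain ⟨S, hS, h1, h2, h3⟩ := hT.exists_move_finset hθ hS₀ (F := F) (by omega)
      {i | ρ i = 1}
    have hlen := hT.hasLengths S hS
    have hstart : LeafPaths T x F ρ S (fun i a => S.pt i (ℓ i - ρ i + a)) := by
      refine ⟨hS, ?_, ?_, ?_, ?_, ?_⟩
      · intro i
        rcases Nat.lt_or_ge (ρ i) 1 with h0 | h0
        · have h0 : ρ i = 0 := by omega
          simp only [hx, h0, Nat.sub_zero, Nat.add_zero]
          rw [hlen.pt_eq_leaf, (hT.hasLengths S₀ hS₀).pt_eq_leaf, h2 i (by simp [h0])]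
        · have h0 : ρ i = 1 := le_antisymm (hρ1 i) h0
          simp only [hx, h0, Nat.add_zero]
          exact h1 i
      · intro i
        have := hρ1 i
        have := (hℓ i).1
        rw [Nat.sub_add_cancel (by omega), hlen.pt_eq_leaf]
      · intro i a ha
        have := hρ1 i
        have := (hℓ i).1
        exact hlen.adj (by omega)
      · intro i j a b ha hb he
        have := hρ1 i
        have := (hℓ i).1
        have := hρ1 j
        have := (hℓ j).1
        exact hinj i j a b ha hb (hlen.pt_inj (by omega) (by omega) he)
      · intro i a ha1 ha2
        have := hρ1 i
        have := (hℓ i).1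
        obtain rfl : a = 1 := by omega
        have h0 : ρ i = 1 := by omega
        rw [h0, Nat.sub_add_cancel (hℓ i).1, hlen.pt_eq_leaf]
        exact h3 i (by simp [h0])
    obtain ⟨S', e', h'⟩ := hstart.extend hT hθ (fun i => (hℓ i).1) (r := r) (by omega)
      fun i => ⟨(k - ℓ i) / 2, by simp only [hρ, hr]; omega⟩
    exact h'.exists_meetingPaths hT (fun i => (hℓ i).1)
      (fun i => by have := (hℓ i).2; simp only [hr]; omega) (by omega)

end Zigzag

/-! ### The exceptional case: `k` even and two legs of length one. -/

section DenseBipartite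

open Finset

/-- A Kővári–Sós–Turán type statement: if each of the at least `θ` vertices `y ∈ Y` has at least
`θ` neighbours in `W`, where `#W ≤ κ * θ` and `θ` is large, then there is a complete bipartite
subgraph with parts of size `N`. -/
theorem exists_complete_bipartite {V : Type*} [DecidableEq V] (κ N θ : ℕ) (hκ : 1 ≤ κ)
    (Y W : Finset V) (Z : V → Finset V) (hY : θ ≤ Y.card) (hW : W.card ≤ κ * θ)
    (hZ : ∀ y ∈ Y, θ ≤ (Z y).card) (hZW : ∀ y ∈ Y, Z y ⊆ W)
    (hθ : 2 * κ * N ≤ θ) (hθ' : 2 * ((2 * κ * N).choose N * N) ≤ θ) (hN : 1 ≤ N) :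
    ∃ A ⊆ Y, A.card = N ∧ ∃ B : Finset V, B.card = N ∧ ∀ y ∈ A, B ⊆ Z y := by
  obtain ⟨A₀, hA₀, hA₀card⟩ := Finset.exists_subset_card_eq (hθ.trans hY)
  set good := {z ∈ W | N ≤ {y ∈ A₀ | z ∈ Z y}.card} with hgood
  -- Double counting between `A₀` and `W`: vertices outside `good` account for at most `N * (κ * θ)`
  -- pairs, half of the total, so `good` has at least `θ / 2` elements.
  have hcount : 2 * κ * N * θ ≤ 2 * κ * N * good.card + N * (κ * θ) := by
    calc 2 * κ * N * θ = ∑ y ∈ A₀, θ := by rw [Finset.sum_const, hA₀card, smul_eq_mul]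
      _ ≤ ∑ y ∈ A₀, (Z y).card := Finset.sum_le_sum fun y hy => hZ y (hA₀ hy)
      _ = ∑ y ∈ A₀, {z ∈ W | z ∈ Z y}.card := by
          refine Finset.sum_congr rfl fun y hy => ?_
          rw [Finset.filter_mem_eq_inter, Finset.inter_eq_right.2 (hZW y (hA₀ hy))]
      _ = ∑ z ∈ W, {y ∈ A₀ | z ∈ Z y}.card :=
          Finset.sum_card_bipartiteAbove_eq_sum_card_bipartiteBelow fun y z => z ∈ Z y
      _ = ∑ z ∈ good, {y ∈ A₀ | z ∈ Z y}.card +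
            ∑ z ∈ W with ¬ N ≤ {y ∈ A₀ | z ∈ Z y}.card, {y ∈ A₀ | z ∈ Z y}.card :=
          (Finset.sum_filter_add_sum_filter_not _ _ _).symm
      _ ≤ good.card * (2 * κ * N) + W.card * N := by
          refine Nat.add_le_add ?_ ?_
          · rw [← smul_eq_mul, ← Finset.sum_const]
            refine Finset.sum_le_sum fun z _ => ?_
            rw [← hA₀card]
            exact Finset.card_filter_le _ _
          · refine le_trans ?_ (Nat.mul_le_mul_right N (Finset.card_filter_le W
              fun z => ¬ N ≤ {y ∈ A₀ | z ∈ Z y}.card))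
            rw [← smul_eq_mul, ← Finset.sum_const]
            refine Finset.sum_le_sum fun z hz => ?_
            have := (Finset.mem_filter.1 hz).2
            omega
      _ ≤ _ := by
          have := Nat.mul_le_mul_left N hW
          nlinarith
  have hlarge : θ ≤ 2 * good.card := by
    have hpos : 0 < κ * N := by positivity
    have : κ * N * θ ≤ κ * N * (2 * good.card) := by nlinarith
    exact Nat.le_of_mul_le_mul_left this hpos
  -- Each good `z` selects an `N`-subset of `A₀` related to it; by pigeonhole some subset is
  -- selected by at least `N` of the `z`.
  have hchoose : ∀ z, ∃ A : Finset V, z ∈ good → A ∈ A₀.powersetCard N ∧ ∀ y ∈ A, z ∈ Z y := by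
    intro z
    by_cases hz : z ∈ good
    · obtain ⟨A, hA, hAcard⟩ := Finset.exists_subset_card_eq (Finset.mem_filter.1 hz).2
      refine ⟨A, fun _ => ⟨Finset.mem_powersetCard.2 ⟨hA.trans (Finset.filter_subset _ _),
        hAcard⟩, fun y hy => (Finset.mem_filter.1 (hA hy)).2⟩⟩
    · exact ⟨∅, fun h => absurd h hz⟩
  choose A hA using hchoose
  have hne : (A₀.powersetCard N).Nonempty := by
    rw [Finset.powersetCard_nonempty, hA₀card]
    nlinarith
  obtain ⟨A₁, hA₁, hfib⟩ := Finset.exists_le_card_fiber_of_mul_le_card_of_maps_to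
    (s := good) (f := A) (n := N) (fun z hz => (hA z hz).1) hne
    (by rw [Finset.card_powersetCard, hA₀card]; omega)
  obtain ⟨B, hB, hBcard⟩ := Finset.exists_subset_card_eq hfib
  rw [Finset.mem_powersetCard] at hA₁
  refine ⟨A₁, hA₁.1.trans hA₀, hA₁.2, B, hBcard, fun y hy z hz => ?_⟩
  obtain ⟨hz1, rfl⟩ := Finset.mem_filter.1 (hB hz)
  exact (hA z hz1).2 y hy

variable {V : Type*} {s t k : ℕ} {G : SimpleGraph V}

/-- The distance of a vertex of the subdivision from the part `Fin s`. -/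
def subdivLevel (s t k : ℕ) : SubdivVertex s t k → ℕ
  | Sum.inl (Sum.inl _) => 0
  | Sum.inl (Sum.inr _) => k
  | Sum.inr (_, _, a) => a + 1

theorem subdivLevel_subdivPoint (i : Fin s) (j : Fin t) {a : ℕ} (ha : a ≤ k) :
    subdivLevel s t k (subdivPoint s t k i j a) = a := by
  unfold subdivPoint
  split_ifs with h1 h2
  · exact h1.symm
  · change a - 1 + 1 = a
    omega
  · change k = a
    omega

/-- If all pairs `X a, Y b` have many common neighbours, and `k` is even, then `G` contains the
subdivided complete bipartite graph. -/
theorem isContained_of_rich_pairs [Finite V] (hk : Even k) (N : ℕ)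
    (hN : 3 * Fintype.card (SubdivVertex s t k) ≤ N)
    (X Y : Fin (Fintype.card (SubdivVertex s t k)) → V) (hX : Function.Injective X)
    (hY : Function.Injective Y) (hXY : ∀ a b, X a ≠ Y b)
    (hrich : ∀ a b, N ≤ {w | G.Adj w (X a) ∧ G.Adj w (Y b)}.ncard) :
    (subdividedCompleteBipartite s t k).IsContained G := by
  classical
  set idx := Fintype.equivFin (SubdivVertex s t k) with hidx
  -- Levels `0, 2, 4, …` of the subdivision alternate between `X` and `Y`, so the two neighbours of
  -- an odd-level vertex lie on opposite sides and form a rich pair.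
  let side : ℕ → Fin (Fintype.card (SubdivVertex s t k)) → V :=
    fun a => if Even (a / 2) then X else Y
  have hside_ne : ∀ a b n m, side a n = side b m → n = m := by
    intro a b n m h
    simp only [side] at h
    split_ifs at h
    exacts [hX h, absurd h (hXY _ _), absurd h.symm (hXY _ _), hY h]
  have hside_rich : ∀ a n m, N ≤ {w | G.Adj w (side a n) ∧ G.Adj w (side (a + 2) m)}.ncard := by
    intro a n m
    have h2 : (a + 2) / 2 = a / 2 + 1 := by omega
    simp only [side, h2, Nat.even_add_one]
    by_cases h : Even (a / 2)
    · simpa [h] using hrich n m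
    · simpa [h, and_comm] using hrich m n
  set R : Finset V := Finset.univ.image X ∪ Finset.univ.image Y with hR
  have hRcard : R.card ≤ 2 * Fintype.card (SubdivVertex s t k) := by
    refine (Finset.card_union_le _ _).trans ?_
    have h1 : (Finset.univ.image X).card ≤ _ := Finset.card_image_le
    have h2 : (Finset.univ.image Y).card ≤ _ := Finset.card_image_le
    simp only [Finset.card_univ, Fintype.card_fin] at h1 h2
    omega
  have hsideR : ∀ a n, side a n ∈ R := by
    intro a n
    simp only [side]
    split_ifs
    · exact Finset.mem_union_left _ (Finset.mem_image_of_mem _ (Finset.mem_univ _))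
    · exact Finset.mem_union_right _ (Finset.mem_image_of_mem _ (Finset.mem_univ _))
  -- The index `p.2.2` stands for level `p.2.2 + 1`, with neighbours at levels `p.2.2` and `p.2.2 +
  -- 2`. Candidates are formed at every level, but only those at odd levels are used.
  let C : (Fin s × Fin t × Fin (k - 1)) → Finset V := fun p =>
    (Set.toFinite {w | G.Adj w (side p.2.2 (idx (subdivPoint s t k p.1 p.2.1 p.2.2))) ∧
      G.Adj w (side (p.2.2 + 2) (idx (subdivPoint s t k p.1 p.2.1 (p.2.2 + 2))))}).toFinset \ R
  have hCcard : ∀ p, Fintype.card (SubdivVertex s t k) ≤ (C p).card := by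
    intro p
    have h1 := hside_rich p.2.2 (idx (subdivPoint s t k p.1 p.2.1 p.2.2))
      (idx (subdivPoint s t k p.1 p.2.1 (p.2.2 + 2)))
    rw [Set.ncard_eq_toFinset_card _ (Set.toFinite _)] at h1
    have h2 := Finset.le_card_sdiff R (Set.toFinite {w |
      G.Adj w (side p.2.2 (idx (subdivPoint s t k p.1 p.2.1 p.2.2))) ∧
      G.Adj w (side (p.2.2 + 2) (idx (subdivPoint s t k p.1 p.2.1 (p.2.2 + 2))))}).toFinset
    simp only [C]
    omega
  -- Hall's condition is immediate: removing `R` costs at most `2M` of the `3M` common neighbours,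
  -- with `M` the number of vertices of the subdivision, so each candidate set alone is large
  -- enough.
  obtain ⟨g, hg, hgC⟩ := (Finset.all_card_le_biUnion_card_iff_exists_injective C).1 (by
    intro P
    rcases P.eq_empty_or_nonempty with rfl | ⟨p, hp⟩
    · simp
    · calc P.card ≤ Fintype.card (Fin s × Fin t × Fin (k - 1)) := Finset.card_le_univ P
        _ ≤ Fintype.card (SubdivVertex s t k) := Fintype.card_le_of_injective Sum.inr
            Sum.inr_injective
        _ ≤ (C p).card := hCcard p
        _ ≤ _ := Finset.card_le_card (Finset.subset_biUnion_of_mem C hp))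
  have hgR : ∀ p, g p ∉ R := fun p => (Finset.mem_sdiff.1 (hgC p)).2
  have hgadj : ∀ p, G.Adj (g p) (side p.2.2 (idx (subdivPoint s t k p.1 p.2.1 p.2.2))) ∧
      G.Adj (g p) (side (p.2.2 + 2) (idx (subdivPoint s t k p.1 p.2.1 (p.2.2 + 2)))) := by
    intro p
    have := (Finset.mem_sdiff.1 (hgC p)).1
    rwa [Set.Finite.mem_toFinset] at this
  let φ : SubdivVertex s t k → V := fun u =>
    match u with
    | Sum.inl b => side (subdivLevel s t k (Sum.inl b)) (idx (Sum.inl b))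
    | Sum.inr p => if Even ((p.2.2 : ℕ) + 1) then side (p.2.2 + 1) (idx (Sum.inr p)) else g p
  have hφ : ∀ u, (Even (subdivLevel s t k u) ∧ φ u = side (subdivLevel s t k u) (idx u)) ∨
      ∃ p, u = Sum.inr p ∧ ¬ Even ((p.2.2 : ℕ) + 1) ∧ φ u = g p := by
    rintro ((i | j) | p)
    · exact Or.inl ⟨Even.zero, rfl⟩
    · exact Or.inl ⟨hk, rfl⟩
    · by_cases h : Even ((p.2.2 : ℕ) + 1)
      · exact Or.inl ⟨h, by simp only [φ, h, if_true]; rfl⟩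
      · exact Or.inr ⟨p, rfl, h, by simp only [φ, h, if_false]⟩
  have hφeven : ∀ i j a, a ≤ k → Even a →
      φ (subdivPoint s t k i j a) = side a (idx (subdivPoint s t k i j a)) := by
    intro i j a ha he
    have hl := subdivLevel_subdivPoint (s := s) (t := t) i j ha
    rcases hφ (subdivPoint s t k i j a) with h | ⟨p, hp, h, -⟩
    · rw [h.2, hl]
    · rw [hp] at hl
      change (p.2.2 : ℕ) + 1 = a at hl
      rw [hl] at h
      exact absurd he h
  have hφodd : ∀ i j a (ha : a < k - 1), Even a →
      φ (subdivPoint s t k i j (a + 1)) = g (i, j, ⟨a, ha⟩) := by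
    intro i j a ha he
    have h1 : subdivPoint s t k i j (a + 1) = Sum.inr (i, j, ⟨a, ha⟩) := by
      simp [subdivPoint, ha]
    rw [h1]
    simp only [φ]
    rw [if_neg]
    rw [Nat.even_add_one]
    simpa using he
  refine subdividedCompleteBipartite_isContained φ ?_ ?_
  · intro u v huv
    rcases hφ u with hu | ⟨p, rfl, -, hu⟩ <;> rcases hφ v with hv | ⟨p', rfl, -, hv⟩
    · rw [hu.2, hv.2] at huv
      exact idx.injective (hside_ne _ _ _ _ huv)
    · rw [hu.2, hv] at huv
      exact absurd (huv ▸ hsideR _ _) (hgR p')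
    · rw [hu, hv.2] at huv
      exact absurd (huv ▸ hsideR _ _) (hgR p)
    · rw [hu, hv] at huv
      rw [hg huv]
  · intro i j a ha
    rcases Nat.even_or_odd a with he | ho
    · have ha' : a < k - 1 := by
        obtain ⟨b, rfl⟩ := he
        obtain ⟨c, rfl⟩ := hk
        omega
      rw [hφeven i j a ha.le he, hφodd i j a ha' he]
      exact (hgadj (i, j, ⟨a, ha'⟩)).1.symm
    · obtain ⟨b, rfl⟩ := ho
      have hb : 2 * b < k - 1 := by omega
      rw [hφodd i j (2 * b) hb (even_two_mul b),
        hφeven i j (2 * b + 1 + 1) ha ⟨b + 1, by ring⟩]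
      exact (hgadj (i, j, ⟨2 * b, hb⟩)).2

variable {T : Set (Spider s G)} {ℓ : Fin s → ℕ} {N θ : ℕ}

/-- A flexible family of spiders with two legs of length one yields a copy of the subdivided
complete bipartite graph if `k` is even. -/
theorem Spider.Flexible.isContained_of_short_legs [Fintype V] [DecidableRel G.Adj]
    (hT : Spider.Flexible T ℓ N θ) (hne : T.Nonempty) (hk : Even k) {i₁ i₂ : Fin s}
    (hi : i₁ ≠ i₂) (h₁ : ℓ i₁ = 1) (h₂ : ℓ i₂ = 1) (M κ : ℕ)
    (hM : M = Fintype.card (SubdivVertex s t k)) (hM1 : 1 ≤ M) (hN : 3 * M ≤ N) (hκ : 1 ≤ κ)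
    (hdeg : G.maxDegree ≤ κ * θ) (hθ : 2 * κ * M ≤ θ)
    (hθ' : 2 * ((2 * κ * M).choose M * M) ≤ θ) :
    (subdividedCompleteBipartite s t k).IsContained G := by
  classical
  subst hM
  obtain ⟨S₀, hS₀⟩ := hne
  set c := S₀.centre with hc
  let rel : V → V → Prop := fun y z => ∃ S ∈ T, S.centre = c ∧ S.leaf i₁ = y ∧ S.leaf i₂ = z
  have hcentre : ∀ {S S' : Spider s G} {m : Fin s → ℕ}, S.trunc m = S'.trunc m →
      S.centre = S'.centre := by
    intro S S' m h
    have := Spider.pt_eq_of_trunc_eq h (j := i₁) (a := 0) (Nat.zero_le _)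
    rwa [Spider.pt_zero, Spider.pt_zero] at this
  have hleafadj : ∀ S ∈ T, ∀ i, ℓ i = 1 → G.Adj S.centre (S.leaf i) := by
    intro S hS i h
    have hlen := hT.hasLengths S hS
    have := hlen.adj (i := i) (a := 0) (by omega)
    rwa [Spider.pt_zero, zero_add, ← h, hlen.pt_eq_leaf] at this
  set Y : Finset V := {y | ∃ z, rel y z} with hY
  set Z : V → Finset V := fun y => {z | rel y z} with hZ
  -- Moving a leaf preserves the centre: a move on leg `i₁` produces elements of `Y`, and one on leg
  -- `i₂` elements of `Z y`.
  have hYcard : θ ≤ Y.card := by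
    refine (hT.move S₀ hS₀ i₁).trans ?_
    rw [← Set.ncard_coe_finset]
    refine Set.ncard_le_ncard ?_ (Finset.finite_toSet _)
    rintro y ⟨S, hS, htr, rfl⟩
    rw [Finset.mem_coe, hY, Finset.mem_filter]
    exact ⟨Finset.mem_univ _, S.leaf i₂, S, hS, hcentre htr, rfl, rfl⟩
  have hZcard : ∀ y ∈ Y, θ ≤ (Z y).card := by
    intro y hy
    rw [hY, Finset.mem_filter] at hy
    obtain ⟨-, z, S, hS, hSc, rfl, -⟩ := hy
    refine (hT.move S hS i₂).trans ?_
    rw [← Set.ncard_coe_finset]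
    refine Set.ncard_le_ncard ?_ (Finset.finite_toSet _)
    rintro z ⟨S', hS', htr, rfl⟩
    rw [Finset.mem_coe, hZ, Finset.mem_filter]
    refine ⟨Finset.mem_univ _, S', hS', (hcentre htr).trans hSc, ?_, rfl⟩
    rw [← (hT.hasLengths S hS).pt_eq_leaf, ← (hT.hasLengths S' hS').pt_eq_leaf]
    exact Spider.pt_eq_of_trunc_eq htr (by simp [hi])
  obtain ⟨A, hAY, hAcard, B, hBcard, hAB⟩ := exists_complete_bipartite κ
    (Fintype.card (SubdivVertex s t k)) θ hκ Y (G.neighborFinset c) Z hYcard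
    (by rw [SimpleGraph.card_neighborFinset_eq_degree]
        exact (G.degree_le_maxDegree c).trans hdeg) hZcard
    (by
      intro y hy z hz
      rw [hZ, Finset.mem_filter] at hz
      obtain ⟨-, S, hS, hSc, -, rfl⟩ := hz
      rw [SimpleGraph.mem_neighborFinset, ← hSc]
      exact hleafadj S hS i₂ h₂) hθ hθ' hM1
  have hrel : ∀ y ∈ A, ∀ z ∈ B, rel y z := fun y hy z hz =>
    (Finset.mem_filter.1 (hAB y hy hz)).2
  have hX := A.equivFinOfCardEq hAcard
  have hY' := B.equivFinOfCardEq hBcard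
  refine isContained_of_rich_pairs hk N hN (fun a => hX.symm a) (fun b => hY'.symm b)
    (Subtype.val_injective.comp hX.symm.injective) (Subtype.val_injective.comp hY'.symm.injective)
    ?_ ?_
  · intro a b he
    obtain ⟨S, hS, -, h3, h4⟩ := hrel _ (hX.symm a).2 _ (hY'.symm b).2
    have hlen := hT.hasLengths S hS
    rw [← h3, ← h4, ← hlen.pt_eq_leaf, ← hlen.pt_eq_leaf] at he
    rcases hlen.pt_inj le_rfl le_rfl he with h | h
    · omega
    · exact hi h.1
  · intro a b
    obtain ⟨S, hS, -, h3, h4⟩ := hrel _ (hX.symm a).2 _ (hY'.symm b).2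
    -- If `X a` and `Y b` had fewer than `N` common neighbours, a switch could avoid them all; yet
    -- the centre of the new spider is one.
    by_contra! hlt
    rw [Set.ncard_eq_toFinset_card _ (Set.toFinite _)] at hlt
    obtain ⟨S', hS', hl, hav⟩ := hT.switch S hS _ hlt.le
    refine hav i₁ 0 (by omega) ?_
    rw [Set.Finite.mem_toFinset, Spider.pt_zero]
    refine ⟨?_, ?_⟩
    · rw [← h3, ← hl]
      exact hleafadj S' hS' i₁ h₁
    · rw [← h4, ← hl]
      exact hleafadj S' hS' i₂ h₂

end DenseBipartite

/-! ### Choice of constants and conclusion. -/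

section Main

open Finset

universe u

/-- For all sufficiently large minimum degrees `δ`, at most `x * n * δ ^ (∑ i, ℓ i)` spiders are
`L`-admissible but not `L`-good. -/
def FewBadSpiders (s t k : ℕ) (K : ℝ) (ℓ : Fin s → ℕ) (L x : ℝ) : Prop :=
  ∃ D : ℕ, ∀ (V : Type u) [Fintype V] (G : SimpleGraph V) [DecidableRel G.Adj],
    IsAlmostRegular K G → (subdividedCompleteBipartite s t k).Free G → D ≤ G.minDegree →
    ({S : Spider s G | S.Admissible L ℓ ∧ ¬ S.Good L ℓ}.ncard : ℝ) ≤
      x * (Fintype.card V : ℝ) * (G.minDegree : ℝ) ^ (∑ i, ℓ i)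

variable {s t k : ℕ} {K : ℝ} {ℓ : Fin s → ℕ} {L : ℝ}

theorem IsAlmostRegular.maxDegree_le {V : Type*} [Fintype V] {G : SimpleGraph V}
    [DecidableRel G.Adj] (h : IsAlmostRegular K G) :
    (G.maxDegree : ℝ) ≤ max K 1 * G.minDegree :=
  h.trans (mul_le_mul_of_nonneg_right (le_max_left _ _) (Nat.cast_nonneg _))

/-- Guarantees that some constant works for each `L`, however small; no freeness is needed. -/
theorem fewBadSpiders_trivial (s t k : ℕ) (K : ℝ) (ℓ : Fin s → ℕ) (L : ℝ) :
    FewBadSpiders.{u} s t k K ℓ L (max K 1 ^ (∑ i, ℓ i)) := by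
  refine ⟨0, fun V _ G _ hK _ _ => ?_⟩
  have h1 : {S : Spider s G | S.Admissible L ℓ ∧ ¬ S.Good L ℓ}.ncard ≤
      Fintype.card V * G.maxDegree ^ (∑ i, ℓ i) :=
    (Set.ncard_le_ncard (fun _ h => h.1.hasLengths) (Spider.finite_hasLengths ℓ)).trans
      (Spider.ncard_hasLengths_le ℓ)
  calc ({S : Spider s G | S.Admissible L ℓ ∧ ¬ S.Good L ℓ}.ncard : ℝ) ≤
      Fintype.card V * (G.maxDegree : ℝ) ^ (∑ i, ℓ i) := by exact_mod_cast h1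
    _ ≤ Fintype.card V * (max K 1 * G.minDegree) ^ (∑ i, ℓ i) := by
        gcongr
        exact hK.maxDegree_le
    _ = _ := by rw [mul_pow]; ring

/-- The witness for `L₀` does not depend on `ε`: only the minimum degree has to grow as `ε` shrinks.
-/
theorem exists_fewBadSpiders (hs : 2 ≤ s) (hk : 2 ≤ k) (K : ℝ)
    (hℓ : ∀ i, 1 ≤ ℓ i ∧ ℓ i ≤ k) {ε : ℝ} (hε : 0 < ε) :
    ∃ L₀ : ℝ, ∀ L, 1 ≤ L → L₀ ≤ L → FewBadSpiders.{u} s t k K ℓ L ε := by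
  set m := ∑ i, ℓ i with hm
  have hmpos : 1 ≤ m := (hℓ ⟨0, by omega⟩).1.trans
    (Finset.single_le_sum (f := ℓ) (fun _ _ => Nat.zero_le _) (Finset.mem_univ _))
  set K' := max K 1 with hK'
  have hK'1 : 1 ≤ K' := le_max_right _ _
  set M := Fintype.card (SubdivVertex s t k) with hM
  have hM1 : 1 ≤ M := Fintype.card_pos_iff.2 ⟨Sum.inl (Sum.inl ⟨0, by omega⟩)⟩
  set N := 3 * M + (s + t * (s * (k + 1)) + s * (k + 1)) with hN
  have hs0 : (0 : ℝ) < s := by exact_mod_cast (by omega : 0 < s)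
  -- With `θ ≤ 2 η δ` and `Δ ≤ K' δ`, this makes the cleaning loss `2 s n Δ^(m-1) θ` at most `(ε /
  -- 2) n δ^m`.
  set η : ℝ := ε / (8 * s * K' ^ (m - 1)) with hη
  have hηpos : 0 < η := by positivity
  -- Chosen so that `Δ ≤ K' δ = (K' / η) (η δ) ≤ κ θ`.
  set κ := ⌈K' / η⌉₊ with hκ
  have hκ1 : 1 ≤ κ := Nat.one_le_iff_ne_zero.2 (Nat.ceil_pos.2 (by positivity)).ne'
  -- Collects every lower bound required of `θ`: exceeding `N` for the zigzag, and the two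
  -- conditions for the complete bipartite piece.
  set C := N + 1 + 2 * κ * M + 2 * ((2 * κ * M).choose M * M) with hC
  refine ⟨2 * (N * m), fun L hL hL₀ => ⟨⌈C / η⌉₊, fun V _ G _ hreg hfree hD => ?_⟩⟩
  by_contra! hbad
  have hδ : (C : ℝ) ≤ η * G.minDegree := by
    have := (Nat.ceil_le.1 hD)
    rw [div_le_iff₀ hηpos] at this
    linarith
  set θ := ⌈η * G.minDegree⌉₊ with hθ
  have hθC : C ≤ θ := by
    have : (C : ℝ) ≤ θ := hδ.trans (Nat.le_ceil _)
    exact_mod_cast this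
  have hC1 : (1 : ℝ) ≤ C := by
    have : 1 ≤ C := by omega
    exact_mod_cast this
  have hθle : (θ : ℝ) ≤ 2 * (η * G.minDegree) := by
    have := Nat.ceil_lt_add_one (a := η * (G.minDegree : ℝ)) (by positivity)
    linarith
  have hΔ : (G.maxDegree : ℝ) ≤ K' * G.minDegree := hreg.maxDegree_le
  have hcount : 2 * (s * (Fintype.card V * G.maxDegree ^ (m - 1)) * θ) <
      {S : Spider s G | S.Admissible L ℓ ∧ ¬ S.Good L ℓ}.ncard := by
    have h1 : (2 : ℝ) * (s * (Fintype.card V * (G.maxDegree : ℝ) ^ (m - 1)) * θ) <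
        ({S : Spider s G | S.Admissible L ℓ ∧ ¬ S.Good L ℓ}.ncard : ℝ) := by
      refine lt_of_le_of_lt ?_ hbad
      calc (2 : ℝ) * (s * (Fintype.card V * (G.maxDegree : ℝ) ^ (m - 1)) * θ)
          ≤ 2 * (s * (Fintype.card V * (K' * G.minDegree) ^ (m - 1)) *
              (2 * (η * G.minDegree))) := by gcongr
        _ = (4 * s * K' ^ (m - 1) * η) * Fintype.card V *
              ((G.minDegree : ℝ) ^ (m - 1) * G.minDegree) := by rw [mul_pow]; ring
        _ = (ε / 2) * Fintype.card V * (G.minDegree : ℝ) ^ m := by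
            rw [← pow_succ, Nat.sub_add_cancel hmpos, hη]
            congr 2
            field_simp
            norm_num
        _ ≤ ε * Fintype.card V * (G.minDegree : ℝ) ^ m := by
            gcongr
            linarith
    exact_mod_cast h1
  obtain ⟨T, hne, hT⟩ := Spider.exists_flexible hs hL ℓ (fun i => (hℓ i).1) N θ hL₀ hcount
  by_cases hpar : ∀ i j, ℓ i = 1 → ℓ j = 1 → Even k → i = j
  · exact hfree (hT.isContained_of_zigzag (by omega) (by omega) hℓ hpar (by omega) (by omega) hne)
  · push Not at hpar
    obtain ⟨i, j, hi, hj, hkeven, hij⟩ := hpar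
    refine hfree (hT.isContained_of_short_legs hne hkeven hij hi hj M κ hM hM1 (by omega) hκ1
      ?_ (by omega) (by omega))
    have h2 : (G.maxDegree : ℝ) ≤ κ * θ := by
      calc (G.maxDegree : ℝ) ≤ K' * G.minDegree := hΔ
        _ = K' / η * (η * G.minDegree) := by field_simp
        _ ≤ κ * θ := by
            gcongr
            · exact Nat.le_ceil _
            · exact Nat.le_ceil _
    exact_mod_cast h2

end Main

theorem lemma10 (s t k : ℕ) (hs : 2 ≤ s) (ht : 2 ≤ t) (hk : 2 ≤ k) (K : ℝ)
    (ℓ : Fin s → ℕ) (hℓ : ∀ i, 1 ≤ ℓ i ∧ ℓ i ≤ k) :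
    ∃ c : ℝ → ℝ, Filter.Tendsto c Filter.atTop (nhds 0) ∧
      ∀ L : ℝ, 1 ≤ L → ∃ D : ℕ,
        ∀ (V : Type*) [Fintype V] (G : SimpleGraph V) [DecidableRel G.Adj],
          IsAlmostRegular K G → (subdividedCompleteBipartite s t k).Free G →
          D ≤ G.minDegree →
          ({S : Spider s G | S.Admissible L ℓ ∧ ¬ S.Good L ℓ}.ncard : ℝ) ≤
            c L * (Fintype.card V : ℝ) * (G.minDegree : ℝ) ^ (∑ i, ℓ i) := by
  -- The function `c` is the infimum of the constants that work for `L`, plus `1 / L`. The extra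
  -- term is needed because the infimum need not be attained: each larger constant comes with its
  -- own `D`.
  set A : ℝ → Set ℝ := fun L => {x | 0 ≤ x ∧ FewBadSpiders s t k K ℓ L x} with hA
  have hbdd : ∀ L, BddBelow (A L) := fun L => ⟨0, fun x hx => hx.1⟩
  have hne : ∀ L, (A L).Nonempty := fun L =>
    ⟨_, by positivity, fewBadSpiders_trivial s t k K ℓ L⟩
  refine ⟨fun L => sInf (A L) + 1 / L, ?_, fun L hL => ?_⟩
  · have h1 : Filter.Tendsto (fun L => sInf (A L)) Filter.atTop (nhds 0) := by
      rw [Metric.tendsto_atTop]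
      intro ε hε
      obtain ⟨L₀, hL₀⟩ := exists_fewBadSpiders (t := t) hs hk K hℓ (half_pos hε)
      refine ⟨max L₀ 1, fun L hL => ?_⟩
      have h2 : sInf (A L) ≤ ε / 2 := csInf_le (hbdd L)
        ⟨(half_pos hε).le, hL₀ L ((le_max_right _ _).trans hL) ((le_max_left _ _).trans hL)⟩
      have h3 : 0 ≤ sInf (A L) := le_csInf (hne L) fun x hx => hx.1
      rw [Real.dist_eq, sub_zero, abs_of_nonneg h3]
      linarith
    have h2 : Filter.Tendsto (fun L : ℝ => 1 / L) Filter.atTop (nhds 0) := by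
      simpa using tendsto_inv_atTop_zero (𝕜 := ℝ)
    simpa using h1.add h2
  · obtain ⟨x, ⟨-, D, hD⟩, hx⟩ := exists_lt_of_csInf_lt (hne L)
      (lt_add_of_pos_right (sInf (A L)) (by positivity : (0 : ℝ) < 1 / L))
    refine ⟨D, fun V _ G _ hreg hfree hδ => (hD V G hreg hfree hδ).trans ?_⟩
    gcongr
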